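/- Let $n\ge 1$, $\mu\in(0,1)$, and let $\Omega_0,\Omega_1\subset\mathbb{R}^n$ be non-empty open bounded convex sets. Put $\Omega_\mu=(1-\mu)\Omega_0+\mu\Omega_1=\{(1-\mu)x_0+\mu x_1: x_0\in\Omega_0,\ x_1\in\Omega_1\}$ and let $D$ be the convex hull of $\Omega_0\cup\Omega_1$ (so $\Omega_0,\Omega_1,\Omega_\mu\subset D$). Let $f\ge 0$ be a smooth function on $D$. For $i=0,1$ let $u_i\in C^2(\Omega_i)\cap C(\overline{\Omega_i})$ be a classical solution of $$\Delta u_i+f(x)=0\ \text{ in }\Omega_i,\qquad u_i=0\ \text{ on }\partial\Omega_i,$$ and let $u_\mu\in C(\overline{\Omega_\mu})$ be a viscosity solution (for instance a classical solution) of $\Delta u_\mu+f(x)=0$ in $\Omega_\mu$, $u_\mu=0$ on $\partial\Omega_\mu$. Here viscosity solution means: for every $x\in\Omega_\mu$ and every $\varphi$ of class $C^2$ near $x$ with $\varphi(x)=u_\mu(x)$, one has $\Delta\varphi(x)+f(x)\ge 0$ if $\varphi\ge u_\mu$ near $x$, and $\Delta\varphi(x)+f(x)\le 0$ if $\varphi\le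 u_\mu$ near $x$. For $q>0$ and $a,b\ge 0$ write $M_q(a,b;\mu)=\left[(1-\mu)a^q+\mu b^q\right]^{1/q}$, and for $r\in(0,\infty)$ write $\|u\|_{L^r(\Omega)}=\left(\int_\Omega|u|^r\,dx\right)^{1/r}$. Then $u_0,u_1,u_\mu$ belong to $L^r$ of their respective domains for every $r\in(0,\infty]$, and the following holds. (a) Suppose that $f^\beta$ is concave on $D$ for some real $\beta\ge 1$. Then, with $p=\frac{\beta}{1+2\beta}$, $$u_\mu\big((1-\mu)x_0+\mu x_1\big)\ \ge\ M_p\big(u_0(x_0),u_1(x_1);\mu\big)\qquad\text{for all }x_0\in\Omega_0,\ x_1\in\Omega_1,$$ and for every $r\in(0,\infty]$ $$\|u_\mu\|_{L^r(\Omega_\mu)}\ \ge\ M_q\big(\|u_0\|_{L^r(\Omega_0)},\|u_1\|_{L^r(\Omega_1)};\mu\big),$$ where $q=\frac{\beta r}{n\beta+r(1+2\beta)}$ if $r<\infty$ and $q=\frac{\beta}{1+2\beta}$ if $r=\infty$. (b) If $f$ is a positive constant on $D$, then the same two inequalities hold with $p=\frac12$ and with $q=\frac{r}{n+2r}$ if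 $r<\infty$, $q=\frac12$ if $r=\infty$. -/

import Mathlib

open Set MeasureTheory Topology InnerProductSpace Laplacian
open scoped Pointwise ContDiff ENNReal

/-- The `μ`-weighted `p`-mean `M_p(a, b; μ)` of two numbers `a, b ≥ 0`, for a real exponent `p`. -/
noncomputable def powerMean (p a b μ : ℝ) : ℝ :=
  if p = 0 then a ^ (1 - μ) * b ^ μ
  else if p < 0 ∧ a * b = 0 then 0
  else ((1 - μ) * a ^ p + μ * b ^ p) ^ (1 / p)

/-- The Minkowski convex combination `(1 - μ) Ω₀ + μ Ω₁`. -/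
def minkowskiCombination {n : ℕ} (μ : ℝ) (Ω₀ Ω₁ : Set (EuclideanSpace ℝ (Fin n))) :
    Set (EuclideanSpace ℝ (Fin n)) :=
  (1 - μ) • Ω₀ + μ • Ω₁

/-- `u` is a classical solution of `Δu + f = 0` in the open set `Ω`, `u = 0` on `∂Ω`:
`u ∈ C²(Ω) ∩ C(closure Ω)` and both equations hold pointwise everywhere. -/
structure IsClassicalSolution {n : ℕ} (f : EuclideanSpace ℝ (Fin n) → ℝ)
    (Ω : Set (EuclideanSpace ℝ (Fin n))) (u : EuclideanSpace ℝ (Fin n) → ℝ) : Prop where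
  contDiffOn : ContDiffOn ℝ 2 u Ω
  continuousOn : ContinuousOn u (closure Ω)
  equation : ∀ x ∈ Ω, Δ u x + f x = 0
  boundary : ∀ x ∈ frontier Ω, u x = 0

/-- `u` is a viscosity solution of `Δu + f = 0` in the open set `Ω`, continuous on the closure of
`Ω`, with `u = 0` on `∂Ω`. Test functions are `C²` near the touching point. -/
structure IsViscositySolution {n : ℕ} (f : EuclideanSpace ℝ (Fin n) → ℝ)
    (Ω : Set (EuclideanSpace ℝ (Fin n))) (u : EuclideanSpace ℝ (Fin n) → ℝ) : Prop where
  continuousOn : ContinuousOn u (closure Ω)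
  /-- a `C²` function touching `u` from above at `x` satisfies `Δφ + f ≥ 0` at `x` -/
  subsolution : ∀ x ∈ Ω, ∀ φ : EuclideanSpace ℝ (Fin n) → ℝ, ContDiffAt ℝ 2 φ x →
    φ x = u x → (∀ᶠ y in 𝓝 x, u y ≤ φ y) → 0 ≤ Δ φ x + f x
  /-- a `C²` function touching `u` from below at `x` satisfies `Δφ + f ≤ 0` at `x` -/
  supersolution : ∀ x ∈ Ω, ∀ φ : EuclideanSpace ℝ (Fin n) → ℝ, ContDiffAt ℝ 2 φ x →
    φ x = u x → (∀ᶠ y in 𝓝 x, φ y ≤ u y) → Δ φ x + f x ≤ 0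
  boundary : ∀ x ∈ frontier Ω, u x = 0

theorem deriv_deriv_nonneg_of_isLocalMin {h : ℝ → ℝ} {t : ℝ} (hm : IsLocalMin h t)
    (hc : ContinuousAt h t) : 0 ≤ deriv (deriv h) t := by
  by_contra! hneg
  have hmax := isLocalMax_of_deriv_deriv_neg hneg hm.deriv_eq_zero hc
  have heq : h =ᶠ[𝓝 t] fun _ => h t := by
    filter_upwards [hm, hmax] with s h1 h2
    exact le_antisymm h2 h1
  have h2 : deriv (deriv h) t = 0 := by
    rw [heq.deriv.deriv_eq]
    simp
  linarith

theorem laplacian_nonneg_of_isLocalMin {n : ℕ} {g : EuclideanSpace ℝ (Fin n) → ℝ}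
    {x : EuclideanSpace ℝ (Fin n)} (hg : ContDiffAt ℝ 2 g x) (hm : IsLocalMin g x) :
    0 ≤ Δ g x := by
  rw [laplacian_eq_iteratedFDeriv_stdOrthonormalBasis]
  refine Finset.sum_nonneg fun i _ => ?_
  generalize stdOrthonormalBasis ℝ (EuclideanSpace ℝ (Fin n)) i = e
  rw [iteratedFDeriv_two_apply]
  have hline : Continuous fun t : ℝ => x + t • e := by fun_prop
  have hd : ∀ t : ℝ, HasDerivAt (fun t : ℝ => x + t • e) e t := fun t => by
    simpa using ((hasDerivAt_id t).smul_const e).const_add x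
  have htend : Filter.Tendsto (fun t : ℝ => x + t • e) (𝓝 0) (𝓝 x) := by
    simpa using hline.tendsto 0
  have hev : ∀ᶠ t : ℝ in 𝓝 0, DifferentiableAt ℝ g (x + t • e) := by
    refine htend.eventually ?_
    filter_upwards [hg.eventually (by simp)] with y hy
    exact hy.differentiableAt (by simp)
  have hd1 : deriv (fun t : ℝ => g (x + t • e)) =ᶠ[𝓝 0] fun t => fderiv ℝ g (x + t • e) e := by
    filter_upwards [hev] with t ht
    exact (ht.hasFDerivAt.comp_hasDerivAt t (hd t)).deriv
  have hg2 : DifferentiableAt ℝ (fderiv ℝ g) (x + (0 : ℝ) • e) := by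
    have : ContDiffAt ℝ 1 (fderiv ℝ g) x := hg.fderiv_right (by norm_num)
    simpa using this.differentiableAt (by simp)
  have hd2 : deriv (deriv fun t : ℝ => g (x + t • e)) 0 = fderiv ℝ (fderiv ℝ g) x e e := by
    rw [hd1.deriv_eq]
    have h1 := hg2.hasFDerivAt.comp_hasDerivAt (0 : ℝ) (hd 0)
    have h2 := (h1.clm_apply (hasDerivAt_const (0 : ℝ) e)).deriv
    simpa using h2
  have hmin : IsLocalMin (fun t : ℝ => g (x + t • e)) 0 := by
    have := htend.eventually hm
    simpa [IsLocalMin, IsMinFilter] using this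
  have hcont : ContinuousAt (fun t : ℝ => g (x + t • e)) 0 := by
    have : ContinuousAt g (x + (0 : ℝ) • e) := by simpa using hg.continuousAt
    exact ContinuousAt.comp (f := fun t : ℝ => x + t • e) this hline.continuousAt
  have := deriv_deriv_nonneg_of_isLocalMin hmin hcont
  rw [hd2] at this
  simpa using this

/-- A classical solution is a viscosity solution. -/
theorem IsClassicalSolution.isViscositySolution {n : ℕ} {f : EuclideanSpace ℝ (Fin n) → ℝ}
    {Ω : Set (EuclideanSpace ℝ (Fin n))} {u : EuclideanSpace ℝ (Fin n) → ℝ} (hΩ : IsOpen Ω)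
    (hu : IsClassicalSolution f Ω u) : IsViscositySolution f Ω u where
  continuousOn := hu.continuousOn
  boundary := hu.boundary
  subsolution x hx φ hφ hφx hle := by
    have hux : ContDiffAt ℝ 2 u x := hu.contDiffOn.contDiffAt (hΩ.mem_nhds hx)
    have hmin : IsLocalMin (φ - u) x := by
      filter_upwards [hle] with y hy
      simp only [Pi.sub_apply]
      linarith
    have h : 0 ≤ Δ (φ - u) x := laplacian_nonneg_of_isLocalMin (hφ.sub hux) hmin
    rw [hφ.laplacian_sub hux] at h
    linarith [hu.equation x hx]
  supersolution x hx φ hφ hφx hle := by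
    have hux : ContDiffAt ℝ 2 u x := hu.contDiffOn.contDiffAt (hΩ.mem_nhds hx)
    have hmin : IsLocalMin (u - φ) x := by
      filter_upwards [hle] with y hy
      simp only [Pi.sub_apply]
      linarith
    have h : 0 ≤ Δ (u - φ) x := laplacian_nonneg_of_isLocalMin (hux.sub hφ) hmin
    rw [hux.laplacian_sub hφ] at h
    linarith [hu.equation x hx]

/-! The pointwise inequality is a maximum principle on the product of the two closed domains. Put r
= 2 + 1/β, p = 1/r, l = 1 - μ, k = μ, and suppose that (l u₀^p + k u₁^p)^r exceeds `uμ` somewhere.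
After adding ε‖·‖² for a small ε, the difference has a maximum (z₀, z₁) at which it is still
positive before the perturbation. Neither u₀(z₀) nor u₁(z₁) can vanish: comparison with a single
scaled homothetic copy of the other solution rules this out. So both points are interior, and
maximality along l x₀ + k x₁ = const makes the gradients of u₀^p and u₁^p agree there.

Write Wᵢ = uᵢ(zᵢ)^p, m = l W₀ + k W₁ and x = l z₀ + k z₁. Moving zᵢ with velocity Wᵢ/m turns the
power mean into a C² function φ of one variable near x, and a perturbed copy of it touches `uμ` from
below at x. With these velocities the gradient terms in Δφ cancel against those in Δu₀ and Δu₁, so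
that Δφ(x) = -m^(r-3) (l W₀^(3-r) f(z₀) + k W₁^(3-r) f(z₁)). Since 3 - r = 1 - 1/β, Hölder's
inequality (`weighted_holder`) and the concavity of f^β give Δφ(x) ≥ -f(x). The supersolution
property, applied with the strictly positive contribution 2nε, is then contradicted
(`IsViscositySolution.powerMean_le`).

The norm inequalities follow by applying the Borell–Brascamp–Lieb inequality to the r-th powers of
the solutions extended by zero. In dimension one it comes from Brunn–Minkowski for superlevel sets
after the maxima are normalized; higher dimensions follow by induction on marginals. A constant f
has every power concave, and β → ∞ gives the exponents of that case. -/

/-! ### Calculus of the Laplacian: powers and homotheties -/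

/-- The squared norm of the gradient, in coordinates of the standard orthonormal basis. -/
noncomputable def gradSq {n : ℕ} (u : EuclideanSpace ℝ (Fin n) → ℝ)
    (x : EuclideanSpace ℝ (Fin n)) : ℝ :=
  ∑ i, (fderiv ℝ u x (stdOrthonormalBasis ℝ (EuclideanSpace ℝ (Fin n)) i)) ^ 2

theorem laplacian_eq_sum_fderiv {n : ℕ} (u : EuclideanSpace ℝ (Fin n) → ℝ)
    (x : EuclideanSpace ℝ (Fin n)) :
    Δ u x = ∑ i, fderiv ℝ (fderiv ℝ u) x (stdOrthonormalBasis ℝ (EuclideanSpace ℝ (Fin n)) i)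
      (stdOrthonormalBasis ℝ (EuclideanSpace ℝ (Fin n)) i) := by
  rw [laplacian_eq_iteratedFDeriv_stdOrthonormalBasis]
  simp [iteratedFDeriv_two_apply]

theorem differentiableAt_fderiv_of_contDiffAt {n : ℕ} {u : EuclideanSpace ℝ (Fin n) → ℝ}
    {x : EuclideanSpace ℝ (Fin n)} (hu : ContDiffAt ℝ 2 u x) :
    DifferentiableAt ℝ (fderiv ℝ u) x := by
  have : ContDiffAt ℝ 1 (fderiv ℝ u) x := hu.fderiv_right (by norm_num)
  exact this.differentiableAt (by simp)

theorem eventually_differentiableAt_of_contDiffAt {n : ℕ} {u : EuclideanSpace ℝ (Fin n) → ℝ}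
    {x : EuclideanSpace ℝ (Fin n)} (hu : ContDiffAt ℝ 2 u x) :
    ∀ᶠ y in 𝓝 x, DifferentiableAt ℝ u y := by
  filter_upwards [hu.eventually (by simp)] with y hy
  exact hy.differentiableAt (by simp)

/-- Chain rule for the Laplacian of `g ∘ u` with a scalar function `g`, whose derivative near
`u x` is `g'`. -/
theorem laplacian_scalar_comp {n : ℕ} {u : EuclideanSpace ℝ (Fin n) → ℝ}
    {x : EuclideanSpace ℝ (Fin n)} (hu : ContDiffAt ℝ 2 u x) {g g' : ℝ → ℝ} {g'' : ℝ}
    (hg : ∀ᶠ s in 𝓝 (u x), HasDerivAt g (g' s) s) (hg' : HasDerivAt g' g'' (u x)) :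
    Δ (fun y => g (u y)) x = g' (u x) * Δ u x + g'' * gradSq u x := by
  have h1 : fderiv ℝ (fun y => g (u y)) =ᶠ[𝓝 x] fun y => g' (u y) • fderiv ℝ u y := by
    filter_upwards [eventually_differentiableAt_of_contDiffAt hu,
      hu.continuousAt.eventually hg] with y hy hgy
    exact (hgy.comp_hasFDerivAt y hy.hasFDerivAt).fderiv
  have h2 := (hg'.comp_hasFDerivAt x (hu.differentiableAt (by simp)).hasFDerivAt).smul
    (differentiableAt_fderiv_of_contDiffAt hu).hasFDerivAt
  have h3 : fderiv ℝ (fderiv ℝ (fun y => g (u y))) x = _ := h1.fderiv_eq.trans h2.fderiv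
  rw [laplacian_eq_sum_fderiv, laplacian_eq_sum_fderiv, h3, gradSq, Finset.mul_sum,
    Finset.mul_sum, ← Finset.sum_add_distrib]
  refine Finset.sum_congr rfl fun i _ => ?_
  simp
  ring

theorem hasFDerivAt_homothety {n : ℕ} (z x y : EuclideanSpace ℝ (Fin n)) (a : ℝ) :
    HasFDerivAt (fun y => z + a • (y - x))
      (a • ContinuousLinearMap.id ℝ (EuclideanSpace ℝ (Fin n))) y :=
  (((hasFDerivAt_id y).sub_const x).const_smul a).const_add z

theorem fderiv_comp_homothety {n : ℕ} {u : EuclideanSpace ℝ (Fin n) → ℝ}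
    {z x y : EuclideanSpace ℝ (Fin n)} (a : ℝ) (hu : DifferentiableAt ℝ u (z + a • (y - x))) :
    fderiv ℝ (fun y => u (z + a • (y - x))) y = a • fderiv ℝ u (z + a • (y - x)) := by
  have h : fderiv ℝ (fun y => u (z + a • (y - x))) y = _ :=
    (hu.hasFDerivAt.comp y (hasFDerivAt_homothety z x y a)).fderiv
  rw [h]
  ext v
  simp

theorem contDiffAt_comp_homothety {n : ℕ} {u : EuclideanSpace ℝ (Fin n) → ℝ}
    {z : EuclideanSpace ℝ (Fin n)} (hu : ContDiffAt ℝ 2 u z) (x : EuclideanSpace ℝ (Fin n))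
    (a : ℝ) : ContDiffAt ℝ 2 (fun y => u (z + a • (y - x))) x := by
  have h : ContDiffAt ℝ 2 (fun y : EuclideanSpace ℝ (Fin n) => z + a • (y - x)) x := by fun_prop
  exact ContDiffAt.comp x (by simpa using hu) h

theorem tendsto_homothety {n : ℕ} (z x : EuclideanSpace ℝ (Fin n)) (a : ℝ) :
    Filter.Tendsto (fun y => z + a • (y - x)) (𝓝 x) (𝓝 z) := by
  have : Continuous fun y : EuclideanSpace ℝ (Fin n) => z + a • (y - x) := by fun_prop
  simpa using this.tendsto x

theorem laplacian_comp_homothety {n : ℕ} {u : EuclideanSpace ℝ (Fin n) → ℝ}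
    {z : EuclideanSpace ℝ (Fin n)} (hu : ContDiffAt ℝ 2 u z) (x : EuclideanSpace ℝ (Fin n))
    (a : ℝ) : Δ (fun y => u (z + a • (y - x))) x = a ^ 2 * Δ u z := by
  have h1 : fderiv ℝ (fun y => u (z + a • (y - x))) =ᶠ[𝓝 x]
      fun y => a • fderiv ℝ u (z + a • (y - x)) := by
    filter_upwards [(tendsto_homothety z x a).eventually
      (eventually_differentiableAt_of_contDiffAt hu)] with y hy
    exact fderiv_comp_homothety a hy
  have h0 : HasFDerivAt (fderiv ℝ u) (fderiv ℝ (fderiv ℝ u) z) (z + a • (x - x)) := by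
    simpa using (differentiableAt_fderiv_of_contDiffAt hu).hasFDerivAt
  have h2 := (h0.comp x (hasFDerivAt_homothety z x x a)).const_smul a
  have h3 : fderiv ℝ (fderiv ℝ (fun y => u (z + a • (y - x)))) x = _ :=
    h1.fderiv_eq.trans h2.fderiv
  rw [laplacian_eq_sum_fderiv, laplacian_eq_sum_fderiv, h3, Finset.mul_sum]
  refine Finset.sum_congr rfl fun i _ => ?_
  simp
  ring

theorem contDiff_normSq {n : ℕ} :
    ContDiff ℝ 2 (fun y : EuclideanSpace ℝ (Fin n) => ‖y‖ ^ 2) := contDiff_norm_sq ℝ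

theorem laplacian_normSq {n : ℕ} (x : EuclideanSpace ℝ (Fin n)) :
    Δ (fun y : EuclideanSpace ℝ (Fin n) => ‖y‖ ^ 2) x = 2 * n := by
  have h1 : fderiv ℝ (fun y : EuclideanSpace ℝ (Fin n) => ‖y‖ ^ 2) =
      fun y => (2 : ℝ) • innerSL ℝ y := by
    ext y v
    rw [fderiv_norm_sq_apply]
    simp
  have h2 : fderiv ℝ (fderiv ℝ (fun y : EuclideanSpace ℝ (Fin n) => ‖y‖ ^ 2)) x =
      (2 : ℝ) • (innerSL ℝ : EuclideanSpace ℝ (Fin n) →L[ℝ] _) := by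
    rw [h1]
    exact ((innerSL ℝ : EuclideanSpace ℝ (Fin n) →L[ℝ] _).hasFDerivAt.const_smul (2 : ℝ)).fderiv
  have h3 : ∀ i, ((2 : ℝ) • (innerSL ℝ : EuclideanSpace ℝ (Fin n) →L[ℝ] _))
      (stdOrthonormalBasis ℝ (EuclideanSpace ℝ (Fin n)) i)
      (stdOrthonormalBasis ℝ (EuclideanSpace ℝ (Fin n)) i) = 2 := by
    intro i
    change (2 : ℝ) * inner ℝ (stdOrthonormalBasis ℝ (EuclideanSpace ℝ (Fin n)) i)
      (stdOrthonormalBasis ℝ (EuclideanSpace ℝ (Fin n)) i) = 2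
    rw [real_inner_self_eq_norm_sq]
    simp
  rw [laplacian_eq_sum_fderiv, h2, Finset.sum_congr rfl fun i _ => h3 i]
  simp [mul_comm]

theorem rpow_hasDerivAt_eventually {s : ℝ} (hs : 0 < s) (p : ℝ) :
    ∀ᶠ t in 𝓝 s, HasDerivAt (fun t : ℝ => t ^ p) (p * t ^ (p - 1)) t := by
  filter_upwards [lt_mem_nhds hs] with t ht
  exact Real.hasDerivAt_rpow_const (Or.inl ht.ne')

/-- The Laplacian of a real power of a positive function. -/
theorem laplacian_rpow {n : ℕ} {u : EuclideanSpace ℝ (Fin n) → ℝ}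
    {x : EuclideanSpace ℝ (Fin n)} (hu : ContDiffAt ℝ 2 u x) (hpos : 0 < u x) (p : ℝ) :
    Δ (fun y => u y ^ p) x =
      p * u x ^ (p - 1) * Δ u x + p * (p - 1) * u x ^ (p - 2) * gradSq u x := by
  have h := laplacian_scalar_comp hu (g' := fun t => p * t ^ (p - 1))
    (rpow_hasDerivAt_eventually hpos p)
    ((Real.hasDerivAt_rpow_const (p := p - 1) (Or.inl hpos.ne')).const_mul p)
  rw [h]
  ring_nf

/-! ### Comparison principle for viscosity solutions -/

/-- If a continuous function is positive somewhere on a compact set, then a small multiple of a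
nonnegative continuous function can be added to it so that the maximum of the sum is attained
where the original function is positive. -/
theorem IsCompact.exists_perturbed_max {α : Type*} [TopologicalSpace α] {K : Set α}
    (hK : IsCompact K) {G N : α → ℝ} (hG : ContinuousOn G K) (hN : ContinuousOn N K)
    (hN0 : ∀ x, 0 ≤ N x) {y : α} (hy : y ∈ K) (hGy : 0 < G y) :
    ∃ ε > 0, ∃ z ∈ K, 0 < G z ∧ ∀ x ∈ K, G x + ε * N x ≤ G z + ε * N z := by
  obtain ⟨b, hb, hbmax⟩ := hK.exists_isMaxOn ⟨y, hy⟩ hN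
  have hR : 0 ≤ N b := hN0 b
  -- The perturbation is then at most G y / 2 on K, so it cannot move the maximum to a point where G
  -- ≤ 0. The summand 1 keeps the denominator positive when N vanishes on K.
  refine ⟨G y / (2 * (N b + 1)), by positivity, ?_⟩
  set ε := G y / (2 * (N b + 1)) with hε
  have hεpos : 0 < ε := by positivity
  obtain ⟨z, hz, hzmax⟩ := hK.exists_isMaxOn ⟨y, hy⟩ (hG.add (hN.const_smul ε))
  refine ⟨z, hz, ?_, fun x hx => hzmax hx⟩
  have h1 : G y + ε * N y ≤ G z + ε * N z := hzmax hy
  have h2 : ε * N z ≤ ε * N b := mul_le_mul_of_nonneg_left (hbmax hz) hεpos.le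
  have h3 : ε * (N b + 1) = G y / 2 := by
    rw [hε]
    field_simp
  have h4 : 0 ≤ ε * N y := mul_nonneg hεpos.le (hN0 y)
  nlinarith

/-- Comparison of a viscosity solution with a classical subsolution, pulled back by the
homothety `x ↦ c + l • x`. -/
theorem IsViscositySolution.le_of_subsolution {n : ℕ} (hn : 1 ≤ n)
    {f w v : EuclideanSpace ℝ (Fin n) → ℝ} {U Ω : Set (EuclideanSpace ℝ (Fin n))}
    (hw : IsViscositySolution f U w) (hΩ : IsOpen Ω) (hΩb : Bornology.IsBounded Ω)
    {c : EuclideanSpace ℝ (Fin n)} {l : ℝ} (hl : 0 < l) (hmaps : ∀ x ∈ Ω, c + l • x ∈ U)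
    (hv : ContDiffOn ℝ 2 v Ω) (hvc : ContinuousOn v (closure Ω))
    (hlap : ∀ x ∈ Ω, 0 ≤ Δ v x + l ^ 2 * f (c + l • x))
    (hbd : ∀ x ∈ frontier Ω, v x ≤ w (c + l • x)) {x : EuclideanSpace ℝ (Fin n)}
    (hx : x ∈ closure Ω) : v x ≤ w (c + l • x) := by
  by_contra! hlt
  have hcont : Continuous fun x : EuclideanSpace ℝ (Fin n) => c + l • x := by fun_prop
  have hmaps' : MapsTo (fun x => c + l • x) (closure Ω) (closure U) :=
    (show MapsTo (fun x => c + l • x) Ω U from hmaps).closure hcont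
  have hwc : ContinuousOn (fun x => w (c + l • x)) (closure Ω) :=
    hw.continuousOn.comp hcont.continuousOn hmaps'
  obtain ⟨ε, hε, z, hz, hzpos, hzmax⟩ := hΩb.isCompact_closure.exists_perturbed_max
    (hvc.sub hwc) (N := fun x => ‖x‖ ^ 2) (by fun_prop) (fun x => by positivity) hx
    (by simpa using hlt)
  have hzΩ : z ∈ Ω := by
    by_contra hzn
    have hzf : z ∈ frontier Ω := by
      rw [hΩ.frontier_eq]
      exact ⟨hz, hzn⟩
    have := hbd z hzf
    simp only [Pi.sub_apply] at hzpos
    linarith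
  have hvz : ContDiffAt ℝ 2 v z := hv.contDiffAt (hΩ.mem_nhds hzΩ)
  -- Subtracting C makes the perturbed subsolution, transported to U by the inverse homothety, equal
  -- to w at c + l • z; maximality at z then makes it touch w from below.
  set C := v z - w (c + l • z) + ε * ‖z‖ ^ 2 with hC
  have hN : ContDiffAt ℝ 2 (fun y : EuclideanSpace ℝ (Fin n) => ‖y‖ ^ 2) z :=
    contDiff_normSq.contDiffAt
  have hN' : ContDiffAt ℝ 2 (ε • fun y : EuclideanSpace ℝ (Fin n) => ‖y‖ ^ 2) z := hN.const_smul ε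
  have hg1 : ContDiffAt ℝ 2 (v + ε • fun y : EuclideanSpace ℝ (Fin n) => ‖y‖ ^ 2) z :=
    hvz.add hN'
  have hg : ContDiffAt ℝ 2 ((v + ε • fun y : EuclideanSpace ℝ (Fin n) => ‖y‖ ^ 2) -
      fun _ => C) z := hg1.sub contDiffAt_const
  have hgl : Δ ((v + ε • fun y : EuclideanSpace ℝ (Fin n) => ‖y‖ ^ 2) -
      fun _ : EuclideanSpace ℝ (Fin n) => C) z =
      Δ v z + ε * (2 * n) := by
    rw [hg1.laplacian_sub contDiffAt_const, hvz.laplacian_add hN',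
      laplacian_smul _ hN, laplacian_normSq]
    simp
  have h := hw.supersolution (c + l • z) (hmaps z hzΩ) _
    (contDiffAt_comp_homothety hg (c + l • z) l⁻¹) (by simp [hC]) (by
      filter_upwards [(tendsto_homothety z (c + l • z) l⁻¹).eventually (hΩ.mem_nhds hzΩ)]
        with y hy
      have hy' : c + l • (z + l⁻¹ • (y - (c + l • z))) = y := by
        rw [smul_add, smul_smul, mul_inv_cancel₀ hl.ne']
        module
      have := hzmax _ (subset_closure hy)
      simp only [Pi.sub_apply, hy'] at this
      simp only [Pi.sub_apply, Pi.add_apply, Pi.smul_apply, smul_eq_mul, hC]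
      linarith)
  rw [laplacian_comp_homothety hg, hgl] at h
  have h2 := hlap z hzΩ
  -- This strict gain from Δ(ε‖·‖²) gives the contradiction; it needs n ≥ 1.
  have h3 : 0 < ε * (2 * (n : ℝ)) := by
    have : (0 : ℝ) < n := by exact_mod_cast hn
    positivity
  have h4 : l ^ 2 * (l⁻¹ ^ 2 * (Δ v z + ε * (2 * n)) + f (c + l • z)) ≤ 0 :=
    mul_nonpos_of_nonneg_of_nonpos (by positivity) h
  have h5 : l ^ 2 * l⁻¹ ^ 2 = 1 := by
    rw [← mul_pow, mul_inv_cancel₀ hl.ne', one_pow]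
  rw [mul_add, ← mul_assoc, h5] at h4
  linarith

/-- Since f ≥ 0, the zero function is a classical subsolution with the same boundary values. -/
theorem IsViscositySolution.nonneg {n : ℕ} (hn : 1 ≤ n)
    {f w : EuclideanSpace ℝ (Fin n) → ℝ} {U : Set (EuclideanSpace ℝ (Fin n))}
    (hw : IsViscositySolution f U w) (hU : IsOpen U) (hUb : Bornology.IsBounded U)
    (hf : ∀ x ∈ U, 0 ≤ f x) {x : EuclideanSpace ℝ (Fin n)} (hx : x ∈ closure U) : 0 ≤ w x := by
  have h := hw.le_of_subsolution hn hU hUb (v := fun _ => 0) (c := 0) (l := 1) one_pos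
    (by simp) contDiffOn_const continuousOn_const
    (fun x hx => by simpa [laplacian_const] using hf x hx)
    (fun x hx => by simp [hw.boundary x hx]) hx
  simpa using h

theorem IsClassicalSolution.nonneg {n : ℕ} (hn : 1 ≤ n)
    {f u : EuclideanSpace ℝ (Fin n) → ℝ} {U : Set (EuclideanSpace ℝ (Fin n))}
    (hu : IsClassicalSolution f U u) (hU : IsOpen U) (hUb : Bornology.IsBounded U)
    (hf : ∀ x ∈ U, 0 ≤ f x) {x : EuclideanSpace ℝ (Fin n)} (hx : x ∈ closure U) : 0 ≤ u x :=
  (hu.isViscositySolution hU).nonneg hn hU hUb hf hx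

/-- A homothetic copy of a solution, scaled by the power `k` of the ratio, lies below a viscosity
solution when `l ^ (k - 2) * f` is dominated by the pulled back right-hand side. -/
theorem IsClassicalSolution.rpow_mul_le {n : ℕ} (hn : 1 ≤ n)
    {f w u : EuclideanSpace ℝ (Fin n) → ℝ} {U Ω : Set (EuclideanSpace ℝ (Fin n))}
    (hu : IsClassicalSolution f Ω u) (hw : IsViscositySolution f U w) (hΩ : IsOpen Ω)
    (hΩb : Bornology.IsBounded Ω) (hU : IsOpen U) (hUb : Bornology.IsBounded U)
    (hf : ∀ x ∈ U, 0 ≤ f x) {c : EuclideanSpace ℝ (Fin n)} {l k : ℝ} (hl : 0 < l)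
    (hmaps : ∀ x ∈ Ω, c + l • x ∈ U) (hfl : ∀ x ∈ Ω, l ^ (k - 2) * f x ≤ f (c + l • x))
    {x : EuclideanSpace ℝ (Fin n)} (hx : x ∈ closure Ω) : l ^ k * u x ≤ w (c + l • x) := by
  have hcont : Continuous fun x : EuclideanSpace ℝ (Fin n) => c + l • x := by fun_prop
  have hmaps' : MapsTo (fun x => c + l • x) (closure Ω) (closure U) :=
    (show MapsTo (fun x => c + l • x) Ω U from hmaps).closure hcont
  have hcu : ContinuousOn (fun y => l ^ k • u y) (closure Ω) :=
    ContinuousOn.const_smul hu.continuousOn (l ^ k)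
  refine hw.le_of_subsolution hn hΩ hΩb (v := fun y => l ^ k • u y) hl hmaps
    (hu.contDiffOn.const_smul (l ^ k)) hcu (fun y hy => ?_)
    (fun y hy => ?_) hx
  · change 0 ≤ Δ (l ^ k • u) y + _
    have hlk : l ^ k = l ^ 2 * l ^ (k - 2) := by
      rw [← Real.rpow_natCast, ← Real.rpow_add hl]
      norm_num
    rw [laplacian_smul _ (hu.contDiffOn.contDiffAt (hΩ.mem_nhds hy)), smul_eq_mul,
      eq_neg_of_add_eq_zero_left (hu.equation y hy), hlk]
    have := mul_le_mul_of_nonneg_left (hfl y hy) (sq_nonneg l)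
    linarith
  · have : 0 ≤ w (c + l • y) :=
      hw.nonneg hn hU hUb hf (hmaps' (frontier_subset_closure hy))
    simpa [hu.boundary y hy] using this

/-! ### Hölder's inequality and the Laplacian of a power mean -/

/-- The two-term weighted Hölder inequality. -/
theorem weighted_holder {l m a b c d θ : ℝ} (hl : 0 ≤ l) (hm : 0 ≤ m) (ha : 0 ≤ a) (hb : 0 ≤ b)
    (hc : 0 ≤ c) (hd : 0 ≤ d) (hθ0 : 0 < θ) (hθ1 : θ ≤ 1) :
    l * (a ^ (1 - θ) * c ^ θ) + m * (b ^ (1 - θ) * d ^ θ) ≤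
      (l * a + m * b) ^ (1 - θ) * (l * c + m * d) ^ θ := by
  -- The endpoint θ = 1, which occurs for β = 1, is separated because the degenerate cases below use
  -- 0 ^ (1 - θ) = 0.
  rcases hθ1.eq_or_lt with rfl | hθ1
  · simp
  have h1 : 0 < 1 - θ := by linarith
  have hA : 0 ≤ l * a + m * b := by positivity
  have hC : 0 ≤ l * c + m * d := by positivity
  have key : ∀ {l a c : ℝ}, 0 ≤ l → 0 ≤ a → 0 ≤ c → l * a = 0 ∨ l * c = 0 →
      l * (a ^ (1 - θ) * c ^ θ) = 0 := by
    intro l a c hl ha hc h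
    rcases h with h | h <;> rcases mul_eq_zero.1 h with h | h <;>
      simp [h, Real.zero_rpow h1.ne', Real.zero_rpow hθ0.ne']
  have hla : 0 ≤ l * a := by positivity
  have hmb : 0 ≤ m * b := by positivity
  have hlc : 0 ≤ l * c := by positivity
  have hmd : 0 ≤ m * d := by positivity
  rcases hA.eq_or_lt with hA0 | hA0
  · rw [key hl ha hc (Or.inl (by linarith)), key hm hb hd (Or.inl (by linarith))]
    simp only [add_zero]
    positivity
  rcases hC.eq_or_lt with hC0 | hC0
  · rw [key hl ha hc (Or.inr (by linarith)), key hm hb hd (Or.inr (by linarith))]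
    simp only [add_zero]
    positivity
  set A := l * a + m * b with hAdef
  set C := l * c + m * d with hCdef
  -- Weighted AM–GM for the normalized quantities a / A and c / C; their weighted sums are 1, so
  -- adding the two instances closes the estimate.
  have young : ∀ {a c : ℝ}, 0 ≤ a → 0 ≤ c →
      a ^ (1 - θ) * c ^ θ ≤ A ^ (1 - θ) * C ^ θ * ((1 - θ) * (a / A) + θ * (c / C)) := by
    intro a c ha hc
    have h := Real.geom_mean_le_arith_mean2_weighted h1.le hθ0.le
      (div_nonneg ha hA) (div_nonneg hc hC) (by ring)
    rw [Real.div_rpow ha hA, Real.div_rpow hc hC] at h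
    have hAp : 0 < A ^ (1 - θ) := Real.rpow_pos_of_pos hA0 _
    have hCp : 0 < C ^ θ := Real.rpow_pos_of_pos hC0 _
    have h2 := mul_le_mul_of_nonneg_left h (mul_pos hAp hCp).le
    calc a ^ (1 - θ) * c ^ θ
        = A ^ (1 - θ) * C ^ θ * (a ^ (1 - θ) / A ^ (1 - θ) * (c ^ θ / C ^ θ)) := by
          field_simp
      _ ≤ _ := h2
  calc l * (a ^ (1 - θ) * c ^ θ) + m * (b ^ (1 - θ) * d ^ θ)
      ≤ l * (A ^ (1 - θ) * C ^ θ * ((1 - θ) * (a / A) + θ * (c / C))) +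
        m * (A ^ (1 - θ) * C ^ θ * ((1 - θ) * (b / A) + θ * (d / C))) :=
        add_le_add (mul_le_mul_of_nonneg_left (young ha hc) hl)
          (mul_le_mul_of_nonneg_left (young hb hd) hm)
    _ = A ^ (1 - θ) * C ^ θ * ((1 - θ) * ((l * a + m * b) / A) + θ * ((l * c + m * d) / C)) := by
        ring
    _ = A ^ (1 - θ) * C ^ θ := by
        rw [← hAdef, ← hCdef, div_self hA0.ne', div_self hC0.ne']
        ring

theorem contDiffAt_rpow {n : ℕ} {u : EuclideanSpace ℝ (Fin n) → ℝ}
    {x : EuclideanSpace ℝ (Fin n)} (hu : ContDiffAt ℝ 2 u x) (hpos : 0 < u x) (p : ℝ) :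
    ContDiffAt ℝ 2 (fun y => u y ^ p) x := hu.rpow_const_of_ne hpos.ne'

/-- The Laplacian of the power mean of two functions along the homotheties with ratios
`w₀ z₀ / m` and `w₁ z₁ / m`, at a point where the gradients of the powers agree. -/
theorem laplacian_powerMean_homothety {n : ℕ} {w₀ w₁ : EuclideanSpace ℝ (Fin n) → ℝ}
    {z₀ z₁ x : EuclideanSpace ℝ (Fin n)} (h₀ : ContDiffAt ℝ 2 w₀ z₀) (h₁ : ContDiffAt ℝ 2 w₁ z₁)
    (hp₀ : 0 < w₀ z₀) (hp₁ : 0 < w₁ z₁) {l k m r : ℝ} (hl : 0 < l) (hk : 0 < k)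
    (hm : m = l * w₀ z₀ + k * w₁ z₁) (hgrad : fderiv ℝ w₀ z₀ = fderiv ℝ w₁ z₁) :
    ContDiffAt ℝ 2 (fun y => (l * w₀ (z₀ + (w₀ z₀ / m) • (y - x)) +
      k * w₁ (z₁ + (w₁ z₁ / m) • (y - x))) ^ r) x ∧
    Δ (fun y => (l * w₀ (z₀ + (w₀ z₀ / m) • (y - x)) +
      k * w₁ (z₁ + (w₁ z₁ / m) • (y - x))) ^ r) x =
    m ^ (r - 3) * (l * (w₀ z₀ ^ (3 - r) * Δ (fun y => w₀ y ^ r) z₀) +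
      k * (w₁ z₁ ^ (3 - r) * Δ (fun y => w₁ y ^ r) z₁)) := by
  have hmpos : 0 < m := by
    rw [hm]
    positivity
  set W₀ := w₀ z₀ with hW₀
  set W₁ := w₁ z₁ with hW₁
  have hc₀ := contDiffAt_comp_homothety h₀ x (W₀ / m)
  have hc₁ := contDiffAt_comp_homothety h₁ x (W₁ / m)
  set ψ₀ := fun y => w₀ (z₀ + (W₀ / m) • (y - x)) with hψ₀
  set ψ₁ := fun y => w₁ (z₁ + (W₁ / m) • (y - x)) with hψ₁
  have hs₀ : ContDiffAt ℝ 2 (l • ψ₀) x := hc₀.const_smul l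
  have hs₁ : ContDiffAt ℝ 2 (k • ψ₁) x := hc₁.const_smul k
  have hψ : ContDiffAt ℝ 2 (l • ψ₀ + k • ψ₁) x := hs₀.add hs₁
  have hval : (l • ψ₀ + k • ψ₁) x = m := by simp [hψ₀, hψ₁, ← hW₀, ← hW₁, hm]
  have hlap : Δ (l • ψ₀ + k • ψ₁) x =
      l * ((W₀ / m) ^ 2 * Δ w₀ z₀) + k * ((W₁ / m) ^ 2 * Δ w₁ z₁) := by
    rw [hs₀.laplacian_add hs₁, laplacian_smul _ hc₀, laplacian_smul _ hc₁,
      laplacian_comp_homothety h₀, laplacian_comp_homothety h₁, smul_eq_mul, smul_eq_mul]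
  -- The ratios satisfy l W₀/m + k W₁/m = 1, so the sum inherits the common gradient unchanged.
  have hfd : fderiv ℝ (l • ψ₀ + k • ψ₁) x = fderiv ℝ w₀ z₀ := by
    have e₀ : fderiv ℝ ψ₀ x = (W₀ / m) • fderiv ℝ w₀ z₀ := by
      have := fderiv_comp_homothety (u := w₀) (z := z₀) (x := x) (y := x) (W₀ / m)
        (by simpa using h₀.differentiableAt (by simp))
      simpa using this
    have e₁ : fderiv ℝ ψ₁ x = (W₁ / m) • fderiv ℝ w₀ z₀ := by
      have := fderiv_comp_homothety (u := w₁) (z := z₁) (x := x) (y := x) (W₁ / m)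
        (by simpa using h₁.differentiableAt (by simp))
      rw [hgrad]
      simpa using this
    rw [fderiv_add (hs₀.differentiableAt (by simp)) (hs₁.differentiableAt (by simp)),
      fderiv_const_smul (hc₀.differentiableAt (by simp)),
      fderiv_const_smul (hc₁.differentiableAt (by simp)), e₀, e₁, smul_smul, smul_smul,
      ← add_smul]
    rw [show l * (W₀ / m) + k * (W₁ / m) = 1 by
      rw [← mul_div_assoc, ← mul_div_assoc, ← add_div, ← hm, div_self hmpos.ne'], one_smul]
  have hN : gradSq (l • ψ₀ + k • ψ₁) x = gradSq w₀ z₀ := by simp only [gradSq, hfd]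
  have hN₁ : gradSq w₁ z₁ = gradSq w₀ z₀ := by simp only [gradSq, hgrad]
  refine ⟨contDiffAt_rpow hψ (hval ▸ hmpos) r, ?_⟩
  have hΔ := laplacian_rpow hψ (hval ▸ hmpos) r
  have hΔ₀ := laplacian_rpow h₀ hp₀ r
  have hΔ₁ := laplacian_rpow h₁ hp₁ r
  rw [hN₁] at hΔ₁
  rw [hval, hlap, hN] at hΔ
  rw [hΔ₀, hΔ₁]
  refine Eq.trans hΔ ?_
  rw [← hW₀, ← hW₁]
  have q1 : ∀ {t : ℝ}, 0 < t → t ^ (3 - r) * t ^ (r - 1) = t ^ 2 := fun {t} ht => by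
    rw [← Real.rpow_add ht, ← Real.rpow_natCast]
    norm_num
  have q2 : ∀ {t : ℝ}, 0 < t → t ^ (3 - r) * t ^ (r - 2) = t := fun {t} ht => by
    rw [← Real.rpow_add ht]
    norm_num
  have q3 : m ^ (r - 1) = m ^ (r - 3) * m ^ 2 := by
    rw [← Real.rpow_natCast, ← Real.rpow_add hmpos]
    congr 1
    norm_num
    ring
  have q4 : m ^ (r - 2) = m ^ (r - 3) * m := by
    nth_rw 3 [← Real.rpow_one m]
    rw [← Real.rpow_add hmpos]
    congr 1
    ring
  have e : ∀ {t D N : ℝ}, 0 < t →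
      t ^ (3 - r) * (r * t ^ (r - 1) * D + r * (r - 1) * t ^ (r - 2) * N) =
        r * t ^ 2 * D + r * (r - 1) * t * N := fun {t D N} ht => by
    rw [← q1 ht]
    nth_rw 6 [← q2 ht]
    ring
  rw [e hp₀, e hp₁, q3, q4]
  have hm2 : m ^ 2 * (W₀ / m) ^ 2 = W₀ ^ 2 := by field_simp
  have hm3 : m ^ 2 * (W₁ / m) ^ 2 = W₁ ^ 2 := by field_simp
  rw [← hm2, ← hm3]
  -- The second-order terms already match. The gradient terms carry the factor m on one side and l
  -- W₀ + k W₁ on the other, which `hm` identifies.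
  linear_combination r * (r - 1) * m ^ (r - 3) * gradSq w₀ z₀ * hm

/-! ### Pointwise power mean inequality -/

theorem IsClassicalSolution.mem_of_pos {n : ℕ} {f u : EuclideanSpace ℝ (Fin n) → ℝ}
    {Ω : Set (EuclideanSpace ℝ (Fin n))} (hu : IsClassicalSolution f Ω u) (hΩ : IsOpen Ω)
    {x : EuclideanSpace ℝ (Fin n)} (hx : x ∈ closure Ω) (hpos : 0 < u x) : x ∈ Ω := by
  by_contra hn
  have : x ∈ frontier Ω := by
    rw [hΩ.frontier_eq]
    exact ⟨hx, hn⟩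
  rw [hu.boundary x this] at hpos
  exact hpos.false

/-- Pointwise comparison with one of the two solutions replaced by zero. -/
theorem IsClassicalSolution.rpow_mul_le_combination {n : ℕ} (hn : 1 ≤ n)
    {f u w : EuclideanSpace ℝ (Fin n) → ℝ} {Ω Ω' U : Set (EuclideanSpace ℝ (Fin n))}
    (hΩ : IsOpen Ω) (hΩb : Bornology.IsBounded Ω) (hU : IsOpen U) (hUb : Bornology.IsBounded U)
    (hu : IsClassicalSolution f Ω u) (hw : IsViscositySolution f U w) {l k β : ℝ} (hl : 0 < l)
    (hk : 0 < k) (hβ : 1 ≤ β) (hmem : ∀ x' ∈ Ω', ∀ x ∈ Ω, l • x' + k • x ∈ U)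
    (hconc : ∀ x' ∈ Ω', ∀ x ∈ Ω, l * f x' ^ β + k * f x ^ β ≤ f (l • x' + k • x) ^ β)
    (hf' : ∀ x ∈ Ω', 0 ≤ f x) (hf : ∀ x ∈ Ω, 0 ≤ f x) (hfU : ∀ x ∈ U, 0 ≤ f x)
    {x' x : EuclideanSpace ℝ (Fin n)} (hx' : x' ∈ closure Ω') (hx : x ∈ closure Ω) :
    k ^ (2 + 1 / β) * u x ≤ w (l • x' + k • x) := by
  have hβ0 : 0 < β := by linarith
  have hcont : Continuous fun y : EuclideanSpace ℝ (Fin n) => l • y + k • x := by fun_prop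
  have hmem' : ∀ y ∈ Ω', l • y + k • x ∈ closure U := fun y hy => by
    have hc : Continuous fun x : EuclideanSpace ℝ (Fin n) => l • y + k • x := by fun_prop
    exact (show MapsTo (fun x => l • y + k • x) Ω U from hmem y hy).closure hc hx
  have hmem'' : MapsTo (fun y => l • y + k • x) (closure Ω') (closure U) := by
    have := (show MapsTo (fun y => l • y + k • x) Ω' (closure U) from hmem').closure hcont
    rwa [closure_closure] at this
  -- For y in the open set Ω' the map z ↦ l • y + k • z sends Ω into U and the homothetic comparison
  -- applies; boundary points x' are reached by continuity.
  refine le_on_closure (s := Ω') (f := fun _ => k ^ (2 + 1 / β) * u x)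
    (g := fun y => w (l • y + k • x)) (fun y hy => ?_) continuousOn_const
    (hw.continuousOn.comp hcont.continuousOn hmem'') hx'
  refine hu.rpow_mul_le hn hw hΩ hΩb hU hUb hfU hk (hmem y hy) (fun z hz => ?_) hx
  have h1 : k * f z ^ β ≤ f (l • y + k • z) ^ β := by
    have := hconc y hy z hz
    have : 0 ≤ l * f y ^ β := mul_nonneg hl.le (Real.rpow_nonneg (hf' y hy) _)
    linarith
  have h2 := Real.rpow_le_rpow (mul_nonneg hk.le (Real.rpow_nonneg (hf z hz) _)) h1
    (by positivity : 0 ≤ 1 / β)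
  rw [Real.mul_rpow hk.le (Real.rpow_nonneg (hf z hz) _), ← Real.rpow_mul (hf z hz),
    ← Real.rpow_mul (hfU _ (hmem y hy z hz)), mul_one_div_cancel hβ0.ne', Real.rpow_one,
    Real.rpow_one] at h2
  simpa using h2

/-- At an interior maximum point of a function of the power mean along `l • x₀ + k • x₁ = const`,
the gradients of the powers agree. -/
theorem fderiv_eq_of_isMax_combination {n : ℕ} {w₀ w₁ : EuclideanSpace ℝ (Fin n) → ℝ}
    {z₀ z₁ : EuclideanSpace ℝ (Fin n)} (h₀ : DifferentiableAt ℝ w₀ z₀)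
    (h₁ : DifferentiableAt ℝ w₁ z₁) {l k : ℝ} (hl : 0 < l) (hk : 0 < k)
    (hmax : ∀ᶠ q in 𝓝 z₀ ×ˢ 𝓝 z₁, l • q.1 + k • q.2 = l • z₀ + k • z₁ →
      l * w₀ q.1 + k * w₁ q.2 ≤ l * w₀ z₀ + k * w₁ z₁) :
    fderiv ℝ w₀ z₀ = fderiv ℝ w₁ z₁ := by
  ext v
  have hd₀ : HasDerivAt (fun t : ℝ => z₀ + t • (k • v)) (k • v) 0 := by
    simpa using ((hasDerivAt_id (0 : ℝ)).smul_const (k • v)).const_add z₀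
  have hd₁ : HasDerivAt (fun t : ℝ => z₁ + t • (-(l • v))) (-(l • v)) 0 := by
    simpa using ((hasDerivAt_id (0 : ℝ)).smul_const (-(l • v))).const_add z₁
  have e₀ : HasFDerivAt w₀ (fderiv ℝ w₀ z₀) (z₀ + (0 : ℝ) • (k • v)) := by
    simpa using h₀.hasFDerivAt
  have e₁ : HasFDerivAt w₁ (fderiv ℝ w₁ z₁) (z₁ + (0 : ℝ) • (-(l • v))) := by
    simpa using h₁.hasFDerivAt
  have hd := ((e₀.comp_hasDerivAt (0 : ℝ) hd₀).const_mul l).add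
    ((e₁.comp_hasDerivAt (0 : ℝ) hd₁).const_mul k)
  have ht : Filter.Tendsto (fun t : ℝ => (z₀ + t • (k • v), z₁ + t • (-(l • v)))) (𝓝 0)
      (𝓝 z₀ ×ˢ 𝓝 z₁) := by
    refine Filter.Tendsto.prodMk ?_ ?_
    · simpa using hd₀.continuousAt.tendsto
    · simpa using hd₁.continuousAt.tendsto
  have hloc : IsLocalMax ((fun t : ℝ => l * (w₀ ∘ fun t : ℝ => z₀ + t • (k • v)) t) +
      fun t : ℝ => k * (w₁ ∘ fun t : ℝ => z₁ + t • (-(l • v))) t) 0 := by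
    filter_upwards [ht.eventually hmax] with t h
    have := h (by module)
    simpa using this
  have := hloc.hasDerivAt_eq_zero hd
  simp only [map_smul, map_neg, smul_eq_mul] at this
  have h2 : l * k * (fderiv ℝ w₀ z₀ v - fderiv ℝ w₁ z₁ v) = 0 := by linarith
  rcases mul_eq_zero.1 h2 with h3 | h3
  · exact absurd h3 (by positivity)
  · linarith

/-- Positivity persists near x, so (u^p)^r = u on a whole neighbourhood. This brings the equations
for u₀ and u₁ into the Laplacian of the power mean. -/
theorem laplacian_rpow_rpow_inv {n : ℕ} {u : EuclideanSpace ℝ (Fin n) → ℝ}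
    {x : EuclideanSpace ℝ (Fin n)} (hu : ContinuousAt u x) (hpos : 0 < u x) {p r : ℝ}
    (hpr : p * r = 1) : Δ (fun y => (u y ^ p) ^ r) x = Δ u x := by
  refine (laplacian_congr_nhds ?_).eq_of_nhds
  filter_upwards [hu.eventually (lt_mem_nhds hpos)] with y hy
  rw [← Real.rpow_mul hy.le, hpr, Real.rpow_one]

/-- The power concavity comparison: the power mean of two classical solutions lies below a
viscosity solution in the Minkowski combination. -/
theorem IsViscositySolution.powerMean_le {n : ℕ} (hn : 1 ≤ n)
    {f u₀ u₁ w : EuclideanSpace ℝ (Fin n) → ℝ} {Ω₀ Ω₁ U : Set (EuclideanSpace ℝ (Fin n))}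
    (hw : IsViscositySolution f U w) (hu₀ : IsClassicalSolution f Ω₀ u₀)
    (hu₁ : IsClassicalSolution f Ω₁ u₁) (hΩ₀ : IsOpen Ω₀) (hΩ₀b : Bornology.IsBounded Ω₀)
    (hΩ₁ : IsOpen Ω₁) (hΩ₁b : Bornology.IsBounded Ω₁) (hU : IsOpen U)
    (hUb : Bornology.IsBounded U) {l k β p : ℝ} (hl : 0 < l) (hk : 0 < k)
    (hβ : 1 ≤ β) (hp : p * (2 + 1 / β) = 1)
    (hmem : ∀ x₀ ∈ Ω₀, ∀ x₁ ∈ Ω₁, l • x₀ + k • x₁ ∈ U)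
    (hconc : ∀ x₀ ∈ Ω₀, ∀ x₁ ∈ Ω₁, l * f x₀ ^ β + k * f x₁ ^ β ≤ f (l • x₀ + k • x₁) ^ β)
    (hf₀ : ∀ x ∈ Ω₀, 0 ≤ f x) (hf₁ : ∀ x ∈ Ω₁, 0 ≤ f x) (hfU : ∀ x ∈ U, 0 ≤ f x)
    {x₀ x₁ : EuclideanSpace ℝ (Fin n)} (hx₀ : x₀ ∈ closure Ω₀) (hx₁ : x₁ ∈ closure Ω₁) :
    (l * u₀ x₀ ^ p + k * u₁ x₁ ^ p) ^ (2 + 1 / β) ≤ w (l • x₀ + k • x₁) := by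
  have hβ0 : 0 < β := by linarith
  set r := 2 + 1 / β with hr
  have hrpos : 0 < r := by positivity
  have hppos : 0 < p := by
    by_contra! h
    have := mul_nonpos_of_nonpos_of_nonneg h hrpos.le
    linarith
  have hn₀ : ∀ x ∈ closure Ω₀, 0 ≤ u₀ x := fun x hx => hu₀.nonneg hn hΩ₀ hΩ₀b hf₀ hx
  have hn₁ : ∀ x ∈ closure Ω₁, 0 ≤ u₁ x := fun x hx => hu₁.nonneg hn hΩ₁ hΩ₁b hf₁ hx
  by_contra! hlt
  set L : EuclideanSpace ℝ (Fin n) × EuclideanSpace ℝ (Fin n) → EuclideanSpace ℝ (Fin n) :=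
    fun q => l • q.1 + k • q.2 with hLdef
  have hL : Continuous L := by fun_prop
  have hmaps : MapsTo L (closure Ω₀ ×ˢ closure Ω₁) (closure U) := by
    rw [← closure_prod_eq]
    exact (show MapsTo L (Ω₀ ×ˢ Ω₁) U from fun q hq => hmem q.1 hq.1 q.2 hq.2).closure hL
  have hc₀ : ContinuousOn (fun q : EuclideanSpace ℝ (Fin n) × EuclideanSpace ℝ (Fin n) => u₀ q.1)
      (closure Ω₀ ×ˢ closure Ω₁) := hu₀.continuousOn.comp continuousOn_fst fun q hq => hq.1
  have hc₁ : ContinuousOn (fun q : EuclideanSpace ℝ (Fin n) × EuclideanSpace ℝ (Fin n) => u₁ q.2)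
      (closure Ω₀ ×ˢ closure Ω₁) := hu₁.continuousOn.comp continuousOn_snd fun q hq => hq.2
  have hM : ContinuousOn (fun q : EuclideanSpace ℝ (Fin n) × EuclideanSpace ℝ (Fin n) =>
      (l * u₀ q.1 ^ p + k * u₁ q.2 ^ p) ^ r) (closure Ω₀ ×ˢ closure Ω₁) :=
    ((continuousOn_const.mul (hc₀.rpow_const fun _ _ => Or.inr hppos.le)).add
      (continuousOn_const.mul (hc₁.rpow_const fun _ _ => Or.inr hppos.le))).rpow_const
      fun _ _ => Or.inr hrpos.le
  obtain ⟨ε, hε, ⟨z₀, z₁⟩, ⟨hz₀, hz₁⟩, hzpos, hzmax⟩ :=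
    (hΩ₀b.isCompact_closure.prod hΩ₁b.isCompact_closure).exists_perturbed_max
    (hM.sub (hw.continuousOn.comp hL.continuousOn hmaps)) (N := fun q => ‖L q‖ ^ 2)
    (by fun_prop) (fun q => by positivity) (y := (x₀, x₁)) ⟨hx₀, hx₁⟩ (by simpa [hLdef] using hlt)
  simp only [Pi.sub_apply, Function.comp_apply] at hz₀ hz₁ hzpos
  -- If u₀ z₀ = 0, the mean reduces to k^r u₁ z₁, which the one-solution comparison bounds by w,
  -- against `hzpos`. Positivity is needed for u₀^p to be C² at z₀ and to exclude the boundary.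
  have hpos₀ : 0 < u₀ z₀ := by
    refine (hn₀ z₀ hz₀).lt_of_ne fun h => ?_
    have := hu₁.rpow_mul_le_combination hn hΩ₁ hΩ₁b hU hUb hw hl hk hβ hmem hconc hf₀ hf₁ hfU hz₀ hz₁
    rw [← h, Real.zero_rpow hppos.ne', mul_zero, zero_add,
      Real.mul_rpow hk.le (Real.rpow_nonneg (hn₁ z₁ hz₁) _), ← Real.rpow_mul (hn₁ z₁ hz₁), hp,
      Real.rpow_one] at hzpos
    linarith
  have hpos₁ : 0 < u₁ z₁ := by
    refine (hn₁ z₁ hz₁).lt_of_ne fun h => ?_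
    have := hu₀.rpow_mul_le_combination (l := k) (k := l) hn hΩ₀ hΩ₀b hU hUb hw hk hl hβ
      (fun x hx y hy => by rw [add_comm]; exact hmem y hy x hx)
      (fun x hx y hy => by rw [add_comm, add_comm (k • x)]; exact hconc y hy x hx)
      hf₁ hf₀ hfU hz₁ hz₀
    rw [add_comm (k • z₁)] at this
    rw [← h, Real.zero_rpow hppos.ne', mul_zero, add_zero,
      Real.mul_rpow hl.le (Real.rpow_nonneg (hn₀ z₀ hz₀) _), ← Real.rpow_mul (hn₀ z₀ hz₀), hp,
      Real.rpow_one] at hzpos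
    linarith
  have hm₀ : z₀ ∈ Ω₀ := hu₀.mem_of_pos hΩ₀ hz₀ hpos₀
  have hm₁ : z₁ ∈ Ω₁ := hu₁.mem_of_pos hΩ₁ hz₁ hpos₁
  have hmax : ∀ y₀ ∈ Ω₀, ∀ y₁ ∈ Ω₁,
      (l * u₀ y₀ ^ p + k * u₁ y₁ ^ p) ^ r - w (l • y₀ + k • y₁) + ε * ‖l • y₀ + k • y₁‖ ^ 2 ≤
      (l * u₀ z₀ ^ p + k * u₁ z₁ ^ p) ^ r - w (l • z₀ + k • z₁) + ε * ‖l • z₀ + k • z₁‖ ^ 2 :=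
    fun y₀ hy₀ y₁ hy₁ => hzmax (y₀, y₁) ⟨subset_closure hy₀, subset_closure hy₁⟩
  have hd₀ : ContDiffAt ℝ 2 u₀ z₀ := hu₀.contDiffOn.contDiffAt (hΩ₀.mem_nhds hm₀)
  have hd₁ : ContDiffAt ℝ 2 u₁ z₁ := hu₁.contDiffOn.contDiffAt (hΩ₁.mem_nhds hm₁)
  have hw₀ := contDiffAt_rpow hd₀ hpos₀ p
  have hw₁ := contDiffAt_rpow hd₁ hpos₁ p
  have hW₀ : 0 < u₀ z₀ ^ p := Real.rpow_pos_of_pos hpos₀ p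
  have hW₁ : 0 < u₁ z₁ ^ p := Real.rpow_pos_of_pos hpos₁ p
  -- Along l q₁ + k q₂ = const both w and the perturbation are constant, so the mean itself is
  -- maximal there; its monotone outer power r can be dropped.
  have hgrad : fderiv ℝ (fun y => u₀ y ^ p) z₀ = fderiv ℝ (fun y => u₁ y ^ p) z₁ := by
    refine fderiv_eq_of_isMax_combination (hw₀.differentiableAt (by simp))
      (hw₁.differentiableAt (by simp)) hl hk ?_
    filter_upwards [Filter.prod_mem_prod (hΩ₀.mem_nhds hm₀) (hΩ₁.mem_nhds hm₁)] with q hq hLq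
    have h := hmax q.1 hq.1 q.2 hq.2
    rw [hLq] at h
    have h1 : 0 ≤ u₀ q.1 ^ p := Real.rpow_nonneg (hn₀ _ (subset_closure hq.1)) _
    have h2 : 0 ≤ u₁ q.2 ^ p := Real.rpow_nonneg (hn₁ _ (subset_closure hq.2)) _
    exact (Real.rpow_le_rpow_iff (by positivity) (by positivity) hrpos).1 (by linarith)
  set m := l * u₀ z₀ ^ p + k * u₁ z₁ ^ p with hm
  have hmpos : 0 < m := by positivity
  set x := l • z₀ + k • z₁ with hx
  obtain ⟨hφ, hφΔ⟩ := laplacian_powerMean_homothety (x := x) (r := r) hw₀ hw₁ hW₀ hW₁ hl hk hm hgrad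
  rw [laplacian_rpow_rpow_inv hd₀.continuousAt hpos₀ hp,
    laplacian_rpow_rpow_inv hd₁.continuousAt hpos₁ hp,
    eq_neg_of_add_eq_zero_left (hu₀.equation z₀ hm₀),
    eq_neg_of_add_eq_zero_left (hu₁.equation z₁ hm₁)] at hφΔ
  set φ := fun y => (l * u₀ (z₀ + (u₀ z₀ ^ p / m) • (y - x)) ^ p +
      k * u₁ (z₁ + (u₁ z₁ ^ p / m) • (y - x)) ^ p) ^ r with hφdef
  have hN : ContDiffAt ℝ 2 (fun y : EuclideanSpace ℝ (Fin n) => ‖y‖ ^ 2) x :=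
    contDiff_normSq.contDiffAt
  have hN' : ContDiffAt ℝ 2 (ε • fun y : EuclideanSpace ℝ (Fin n) => ‖y‖ ^ 2) x := hN.const_smul ε
  have hg : ContDiffAt ℝ 2 (φ + ε • fun y : EuclideanSpace ℝ (Fin n) => ‖y‖ ^ 2) x := hφ.add hN'
  set C := m ^ r - w x + ε * ‖x‖ ^ 2 with hC
  have hsup := hw.supersolution x (hmem _ hm₀ _ hm₁)
    ((φ + ε • fun y : EuclideanSpace ℝ (Fin n) => ‖y‖ ^ 2) - fun _ => C)
    (hg.sub contDiffAt_const) (by simp [hφdef, hC, ← hm]) (by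
      filter_upwards [(tendsto_homothety z₀ x (u₀ z₀ ^ p / m)).eventually (hΩ₀.mem_nhds hm₀),
        (tendsto_homothety z₁ x (u₁ z₁ ^ p / m)).eventually (hΩ₁.mem_nhds hm₁)] with y h₀ h₁
      have h := hmax _ h₀ _ h₁
      -- The two moving points always combine to y, since their velocities have weighted sum 1;
      -- hence the value at y is controlled by the maximum over pairs.
      have hy : l • (z₀ + (u₀ z₀ ^ p / m) • (y - x)) + k • (z₁ + (u₁ z₁ ^ p / m) • (y - x)) =
          y := by
        have h1 : l * (u₀ z₀ ^ p / m) + k * (u₁ z₁ ^ p / m) = 1 := by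
          rw [← mul_div_assoc, ← mul_div_assoc, ← add_div, ← hm, div_self hmpos.ne']
        calc _ = x + (l * (u₀ z₀ ^ p / m) + k * (u₁ z₁ ^ p / m)) • (y - x) := by
              rw [hx]
              module
          _ = y := by
              rw [h1, one_smul]
              abel
      rw [hy] at h
      simp only [Pi.sub_apply, Pi.add_apply, Pi.smul_apply, smul_eq_mul, hφdef]
      linarith)
  rw [hg.laplacian_sub contDiffAt_const, hφ.laplacian_add hN', laplacian_smul _ hN,
    laplacian_normSq, hφΔ] at hsup
  -- This identity is what fixes r = 2 + 1/β: the weights Wᵢ^(3-r) are exactly those of Hölder's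
  -- inequality with θ = 1/β.
  have hθ : 3 - r = 1 - 1 / β := by
    rw [hr]
    ring
  have hf0 := hf₀ z₀ hm₀
  have hf1 := hf₁ z₁ hm₁
  have hfx := hfU x (hmem _ hm₀ _ hm₁)
  have hfβ : ∀ {t : ℝ}, 0 ≤ t → (t ^ β) ^ (1 / β) = t := fun {t} ht => by
    rw [← Real.rpow_mul ht, mul_one_div_cancel hβ0.ne', Real.rpow_one]
  have hH := weighted_holder hl.le hk.le hW₀.le hW₁.le (Real.rpow_nonneg hf0 β)
    (Real.rpow_nonneg hf1 β) (θ := 1 / β) (by positivity) ((div_le_one hβ0).2 hβ)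
  have hconc' := Real.rpow_le_rpow (by positivity) (hconc z₀ hm₀ z₁ hm₁)
    (by positivity : 0 ≤ 1 / β)
  rw [← hx, hfβ hfx] at hconc'
  rw [← hm, hfβ hf0, hfβ hf1, ← hθ] at hH
  have hmθ : 0 < m ^ (3 - r) := Real.rpow_pos_of_pos hmpos _
  have hH' := hH.trans (mul_le_mul_of_nonneg_left hconc' hmθ.le)
  have hinv : m ^ (r - 3) * m ^ (3 - r) = 1 := by
    rw [← Real.rpow_add hmpos]
    simp
  have hH'' := mul_le_mul_of_nonneg_left hH' (Real.rpow_pos_of_pos hmpos (r - 3)).le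
  rw [← mul_assoc (m ^ (r - 3)) (m ^ (3 - r)), hinv, one_mul] at hH''
  have hεn : 0 < ε * (2 * (n : ℝ)) := by
    have : (0 : ℝ) < n := by exact_mod_cast hn
    positivity
  simp only [laplacian_const, Pi.zero_apply, smul_eq_mul, sub_zero] at hsup
  linarith

/-! ### Brunn–Minkowski and Borell–Brascamp–Lieb on the line -/

/-- The one-dimensional Brunn–Minkowski inequality for compact sets. -/
theorem volume_combination_le {A B S : Set ℝ} (hA : IsCompact A) (hB : IsCompact B)
    (hA0 : A.Nonempty) (hB0 : B.Nonempty) {l k : ℝ} (hl : 0 < l) (hk : 0 < k)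
    (h : ∀ a ∈ A, ∀ b ∈ B, l * a + k * b ∈ S) :
    ENNReal.ofReal l * volume A + ENNReal.ofReal k * volume B ≤ volume S := by
  -- With a = max A and b = min B, the translates l A + k b and l a + k B both lie in S and can meet
  -- only at l a + k b.
  obtain ⟨a, ha, hamax⟩ := hA.exists_isGreatest hA0
  obtain ⟨b, hb, hbmin⟩ := hB.exists_isLeast hB0
  have hvA : volume ((fun x => x + k * b) '' (l • A)) = ENNReal.ofReal l * volume A := by
    rw [image_add_right, measure_preimage_add_right, Measure.addHaar_smul_of_nonneg _ hl.le]
    simp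
  have hvB : volume ((fun x => l * a + x) '' (k • B)) = ENNReal.ofReal k * volume B := by
    rw [image_add_left, measure_preimage_add, Measure.addHaar_smul_of_nonneg _ hk.le]
    simp
  have hcB : IsCompact ((fun x => l * a + x) '' (k • B)) := (hB.smul k).image (by fun_prop)
  have hdisj : AEDisjoint volume ((fun x => x + k * b) '' (l • A))
      ((fun x => l * a + x) '' (k • B)) := by
    refine measure_mono_null (t := {l * a + k * b}) ?_ (by simp)
    rintro _ ⟨⟨_, ⟨x, hx, rfl⟩, rfl⟩, ⟨_, ⟨y, hy, rfl⟩, hxy⟩⟩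
    have h1 := mul_le_mul_of_nonneg_left (hamax hx) hl.le
    have h2 := mul_le_mul_of_nonneg_left (hbmin hy) hk.le
    simp only [smul_eq_mul] at hxy ⊢
    rw [mem_singleton_iff]
    linarith
  rw [← hvA, ← hvB, ← measure_union₀ hcB.measurableSet.nullMeasurableSet hdisj]
  refine measure_mono (union_subset ?_ ?_)
  · rintro _ ⟨_, ⟨x, hx, rfl⟩, rfl⟩
    exact h x hx b hb
  · rintro _ ⟨_, ⟨y, hy, rfl⟩, rfl⟩
    exact h a ha y hy

theorem isCompact_superlevel {f : ℝ → ℝ} (hf : Continuous f) (hc : HasCompactSupport f) {t : ℝ}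
    (ht : 0 < t) : IsCompact {x | t ≤ f x} := by
  refine hc.of_isClosed_subset (isClosed_le continuous_const hf) fun x hx => ?_
  exact subset_tsupport f (ne_of_gt (ht.trans_le hx))

/-- The normalized one-dimensional inequality: if superlevel sets of functions with maximum one
combine, then integrals combine linearly. -/
theorem integral_combination_le {f g h : ℝ → ℝ} (hf : Continuous f) (hg : Continuous g)
    (hh : Continuous h) (hfc : HasCompactSupport f) (hgc : HasCompactSupport g)
    (hhc : HasCompactSupport h) (hf0 : ∀ x, 0 ≤ f x) (hg0 : ∀ x, 0 ≤ g x) (hh0 : ∀ x, 0 ≤ h x)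
    {a b : ℝ} (ha : f a = 1) (hb : g b = 1) (hamax : ∀ x, f x ≤ 1) (hbmax : ∀ x, g x ≤ 1)
    {l k : ℝ} (hl : 0 < l) (hk : 0 < k)
    (hlev : ∀ t, 0 < t → ∀ x y, t ≤ f x → t ≤ g y → t ≤ h (l * x + k * y)) :
    l * (∫ x, f x) + k * (∫ x, g x) ≤ ∫ x, h x := by
  have hfi : Integrable f := hf.integrable_of_hasCompactSupport hfc
  have hgi : Integrable g := hg.integrable_of_hasCompactSupport hgc
  have hhi : Integrable h := hh.integrable_of_hasCompactSupport hhc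
  have hF := ofReal_integral_eq_lintegral_ofReal hfi (ae_of_all _ hf0)
  have hG := ofReal_integral_eq_lintegral_ofReal hgi (ae_of_all _ hg0)
  have hH := ofReal_integral_eq_lintegral_ofReal hhi (ae_of_all _ hh0)
  rw [lintegral_eq_lintegral_meas_le _ (ae_of_all _ hf0) hfi.1.aemeasurable] at hF
  rw [lintegral_eq_lintegral_meas_le _ (ae_of_all _ hg0) hgi.1.aemeasurable] at hG
  rw [lintegral_eq_lintegral_meas_le _ (ae_of_all _ hh0) hhi.1.aemeasurable] at hH
  have hIf : 0 ≤ ∫ x, f x := integral_nonneg hf0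
  have hIg : 0 ≤ ∫ x, g x := integral_nonneg hg0
  rw [← ENNReal.ofReal_le_ofReal_iff (integral_nonneg hh0),
    ENNReal.ofReal_add (by positivity) (by positivity), ENNReal.ofReal_mul hl.le,
    ENNReal.ofReal_mul hk.le, hF, hG, hH, ← lintegral_const_mul' _ _ ENNReal.ofReal_ne_top,
    ← lintegral_const_mul' _ _ ENNReal.ofReal_ne_top]
  refine (le_lintegral_add _ _).trans (setLIntegral_mono' measurableSet_Ioi fun t ht => ?_)
  -- Equal maxima make the superlevel sets nonempty for the same t: both are nonempty for t ≤ 1 and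
  -- both empty for t > 1, so Brunn–Minkowski is never applied to an empty set.
  rcases le_or_gt t 1 with ht1 | ht1
  · exact volume_combination_le (isCompact_superlevel hf hfc ht) (isCompact_superlevel hg hgc ht)
      ⟨a, by simpa [ha] using ht1⟩ ⟨b, by simpa [hb] using ht1⟩ hl hk
      fun x hx y hy => hlev t ht x y hx hy
  · have e1 : {x | t ≤ f x} = ∅ := by
      ext x
      simpa using (hamax x).trans_lt ht1
    have e2 : {x | t ≤ g x} = ∅ := by
      ext x
      simpa using (hbmax x).trans_lt ht1
    simp [e1, e2]

/-- The Borell–Brascamp–Lieb inequality on the real line, for continuous functions with compact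
support and power means of positive exponent `1 / s`. -/
theorem borell_brascamp_lieb_real {f g h : ℝ → ℝ} (hf : Continuous f) (hg : Continuous g)
    (hh : Continuous h) (hfc : HasCompactSupport f) (hgc : HasCompactSupport g)
    (hhc : HasCompactSupport h) (hf0 : ∀ x, 0 ≤ f x) (hg0 : ∀ x, 0 ≤ g x) (hh0 : ∀ x, 0 ≤ h x)
    (hfi : 0 < ∫ x, f x) (hgi : 0 < ∫ x, g x) {l k s : ℝ} (hl : 0 < l) (hk : 0 < k) (hs : 0 < s)
    (hfgh : ∀ x y, 0 < f x → 0 < g y →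
      (l * f x ^ (1 / s) + k * g y ^ (1 / s)) ^ s ≤ h (l * x + k * y)) :
    (l * (∫ x, f x) ^ (1 / (s + 1)) + k * (∫ x, g x) ^ (1 / (s + 1))) ^ (s + 1) ≤ ∫ x, h x := by
  obtain ⟨a, ha⟩ := hf.exists_forall_ge_of_hasCompactSupport hfc
  obtain ⟨b, hb⟩ := hg.exists_forall_ge_of_hasCompactSupport hgc
  have hpos : ∀ {f : ℝ → ℝ} {a : ℝ}, (0 < ∫ x, f x) → (∀ x, f x ≤ f a) → 0 < f a := by
    intro f a hfi ha
    by_contra! hneg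
    exact absurd (integral_nonpos fun x => (ha x).trans hneg) (not_le.2 hfi)
  have hF := hpos hfi ha
  have hG := hpos hgi hb
  set F := f a
  set G := g b
  set I := ∫ x, f x
  set J := ∫ x, g x
  have hFs : 0 < F ^ (1 / s) := Real.rpow_pos_of_pos hF _
  have hGs : 0 < G ^ (1 / s) := Real.rpow_pos_of_pos hG _
  -- H = T ^ s is the power mean of the two maxima. By homogeneity, t F ≤ f x and t G ≤ g y force t
  -- H ≤ h (l x + k y), the level-set condition for the quotients by F, G and H.
  set T := l * F ^ (1 / s) + k * G ^ (1 / s) with hT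
  have hTpos : 0 < T := by positivity
  set H := T ^ s with hHdef
  have hHpos : 0 < H := Real.rpow_pos_of_pos hTpos s
  have hss : 1 / s * s = 1 := by field_simp
  have key := integral_combination_le (f := fun x => f x / F) (g := fun x => g x / G)
    (h := fun x => h x / H) (hf.div_const F) (hg.div_const G) (hh.div_const H)
    (hfc.comp_left (g := fun y => y / F) (by simp))
    (hgc.comp_left (g := fun y => y / G) (by simp))
    (hhc.comp_left (g := fun y => y / H) (by simp))
    (fun x => div_nonneg (hf0 x) hF.le) (fun x => div_nonneg (hg0 x) hG.le)
    (fun x => div_nonneg (hh0 x) hHpos.le) (a := a) (b := b) (div_self hF.ne') (div_self hG.ne')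
    (fun x => (div_le_one hF).2 (ha x)) (fun x => (div_le_one hG).2 (hb x)) hl hk
    (fun t ht x y hx hy => by
      rw [le_div_iff₀ hF] at hx
      rw [le_div_iff₀ hG] at hy
      rw [le_div_iff₀ hHpos]
      refine le_trans ?_ (hfgh x y (by nlinarith [mul_pos ht hF]) (by nlinarith [mul_pos ht hG]))
      have h1 := Real.rpow_le_rpow (by positivity) hx (by positivity : 0 ≤ 1 / s)
      have h2 := Real.rpow_le_rpow (by positivity) hy (by positivity : 0 ≤ 1 / s)
      rw [Real.mul_rpow ht.le hF.le] at h1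
      rw [Real.mul_rpow ht.le hG.le] at h2
      calc t * H = (t ^ (1 / s) * T) ^ s := by
            rw [Real.mul_rpow (by positivity) hTpos.le, ← Real.rpow_mul ht.le, hss, Real.rpow_one]
        _ = (l * (t ^ (1 / s) * F ^ (1 / s)) + k * (t ^ (1 / s) * G ^ (1 / s))) ^ s := by
            rw [hT]
            ring_nf
        _ ≤ _ := by gcongr)
  simp only [integral_div] at key
  have hθ : 0 < 1 / (s + 1) := by positivity
  -- Hölder with θ = 1/(s+1) undoes the normalization: (F^(1/s))^(1-θ) (I/F)^θ = I^θ, so the maxima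
  -- drop out and the exponent s becomes s + 1.
  have hH := weighted_holder hl.le hk.le hFs.le hGs.le (div_nonneg hfi.le hF.le)
    (div_nonneg hgi.le hG.le) hθ ((div_le_one (by positivity)).2 (by linarith))
  have e : ∀ {F I : ℝ}, 0 < F → 0 ≤ I →
      (F ^ (1 / s)) ^ (1 - 1 / (s + 1)) * (I / F) ^ (1 / (s + 1)) = I ^ (1 / (s + 1)) := by
    intro F I hF hI
    rw [← Real.rpow_mul hF.le, Real.div_rpow hI hF.le]
    have : 1 / s * (1 - 1 / (s + 1)) = 1 / (s + 1) := by
      field_simp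
      ring
    rw [this]
    have : 0 < F ^ (1 / (s + 1)) := Real.rpow_pos_of_pos hF _
    field_simp
  rw [e hF hfi.le, e hG hgi.le, ← hT] at hH
  have hsum : 0 ≤ l * (I / F) + k * (J / G) := by positivity
  have h1 := Real.rpow_le_rpow (by positivity) hH (by positivity : 0 ≤ s + 1)
  refine h1.trans ?_
  rw [Real.mul_rpow (by positivity) (by positivity), ← Real.rpow_mul hTpos.le,
    ← Real.rpow_mul hsum]
  have e1 : (1 - 1 / (s + 1)) * (s + 1) = s := by
    field_simp
    ring
  have e2 : 1 / (s + 1) * (s + 1) = 1 := by field_simp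
  rw [e1, e2, Real.rpow_one, ← hHdef]
  rw [le_div_iff₀ hHpos] at key
  linarith

/-! ### Borell–Brascamp–Lieb in higher dimensions by induction on marginals -/

theorem continuous_finCons {n : ℕ} :
    Continuous fun q : ℝ × (Fin n → ℝ) => (Fin.cons q.1 q.2 : Fin (n + 1) → ℝ) :=
  Continuous.finCons (A := fun _ => ℝ) continuous_fst continuous_snd

theorem hasCompactSupport_comp_finCons {n : ℕ} {f : (Fin (n + 1) → ℝ) → ℝ}
    (hfc : HasCompactSupport f) :
    HasCompactSupport fun q : ℝ × (Fin n → ℝ) => f (Fin.cons q.1 q.2) := by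
  refine HasCompactSupport.intro (K := (fun x => (x 0, Fin.tail x)) '' tsupport f)
    (hfc.image (by unfold Fin.tail; fun_prop)) fun q hq => ?_
  by_contra hne
  exact hq ⟨Fin.cons q.1 q.2, subset_tsupport f hne, by simp⟩

theorem integral_finCons {n : ℕ} {f : (Fin (n + 1) → ℝ) → ℝ} (hf : Continuous f)
    (hfc : HasCompactSupport f) : ∫ x, f x = ∫ t, ∫ y, f (Fin.cons t y) := by
  have h := (volume_preserving_piFinSuccAbove (fun _ : Fin (n + 1) => ℝ) 0).symm
  rw [← h.integral_comp (MeasurableEquiv.measurableEmbedding _)]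
  have e : ∀ q : ℝ × (Fin n → ℝ),
      (MeasurableEquiv.piFinSuccAbove (fun _ : Fin (n + 1) => ℝ) 0).symm q =
        Fin.cons q.1 q.2 := fun q => by
    simp [MeasurableEquiv.piFinSuccAbove, Fin.insertNthEquiv]
  simp only [e]
  exact integral_prod _ ((hf.comp continuous_finCons).integrable_of_hasCompactSupport
    (hasCompactSupport_comp_finCons hfc))

/-- Together with compact support, this keeps the marginals in the class to which the
one-dimensional inequality applies. -/
theorem continuous_integral_finCons {n : ℕ} {f : (Fin (n + 1) → ℝ) → ℝ} (hf : Continuous f)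
    (hfc : HasCompactSupport f) : Continuous fun t : ℝ => ∫ y, f (Fin.cons t y) := by
  rw [← continuousOn_univ]
  refine continuousOn_integral_of_compact_support (k := Fin.tail '' tsupport f)
    (hfc.image (by unfold Fin.tail; fun_prop)) (hf.comp continuous_finCons).continuousOn
    fun t y _ hy => ?_
  by_contra hne
  exact hy ⟨Fin.cons t y, subset_tsupport f hne, by simp⟩

theorem hasCompactSupport_integral_finCons {n : ℕ} {f : (Fin (n + 1) → ℝ) → ℝ}
    (hfc : HasCompactSupport f) : HasCompactSupport fun t : ℝ => ∫ y, f (Fin.cons t y) := by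
  refine HasCompactSupport.intro (K := (fun x => x 0) '' tsupport f)
    (hfc.image (by fun_prop)) fun t ht => ?_
  refine integral_eq_zero_of_ae (ae_of_all _ fun y => ?_)
  by_contra hne
  exact ht ⟨Fin.cons t y, subset_tsupport f hne, by simp⟩

/-- The Borell–Brascamp–Lieb inequality for continuous functions with compact support and power
means of positive exponent `1 / s`. -/
theorem borell_brascamp_lieb_pi {l k s : ℝ} (hl : 0 < l) (hk : 0 < k) (hs : 0 < s) (n : ℕ) :
    ∀ {f g h : (Fin n → ℝ) → ℝ}, Continuous f → Continuous g → Continuous h →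
      HasCompactSupport f → HasCompactSupport g → HasCompactSupport h →
      (∀ x, 0 ≤ f x) → (∀ x, 0 ≤ g x) → (∀ x, 0 ≤ h x) → (0 < ∫ x, f x) → (0 < ∫ x, g x) →
      (∀ x y, 0 < f x → 0 < g y →
        (l * f x ^ (1 / s) + k * g y ^ (1 / s)) ^ s ≤ h (l • x + k • y)) →
      (l * (∫ x, f x) ^ (1 / (s + n)) + k * (∫ x, g x) ^ (1 / (s + n))) ^ (s + n) ≤
        ∫ x, h x := by
  induction n with
  | zero =>
    intro f g h _ _ _ _ _ _ _ _ _ hfi hgi hfgh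
    -- In dimension zero the integral is evaluation at the only point, and the claim is the
    -- hypothesis itself.
    have hv : (volume : Measure (Fin 0 → ℝ)).real univ = 1 := by
      rw [measureReal_def, volume_pi, Measure.pi_univ]
      simp
    have hint : ∀ F : (Fin 0 → ℝ) → ℝ, ∫ x, F x = F default := fun F => by
      rw [integral_unique, hv, one_smul]
      exact congrArg F (Subsingleton.elim _ _)
    rw [hint] at hfi hgi
    have := hfgh default default hfi hgi
    rw [Subsingleton.elim (l • default + k • default) (default : Fin 0 → ℝ)] at this
    simpa only [hint, Nat.cast_zero, add_zero] using this
  | succ n ih =>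
    intro f g h hf hg hh hfc hgc hhc hf0 hg0 hh0 hfi hgi hfgh
    rw [integral_finCons hf hfc] at hfi ⊢
    rw [integral_finCons hg hgc] at hgi ⊢
    rw [integral_finCons hh hhc]
    have hsec : ∀ {f : (Fin (n + 1) → ℝ) → ℝ}, Continuous f → ∀ t : ℝ,
        Continuous fun y : Fin n → ℝ => f (Fin.cons t y) := fun hf t =>
      hf.comp (continuous_finCons.comp (Continuous.prodMk_right t))
    have hsecc : ∀ {f : (Fin (n + 1) → ℝ) → ℝ}, HasCompactSupport f → ∀ t : ℝ,
        HasCompactSupport fun y : Fin n → ℝ => f (Fin.cons t y) := fun {f} hfc t => by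
      refine HasCompactSupport.intro (K := Fin.tail '' tsupport f)
        (hfc.image (by unfold Fin.tail; fun_prop)) fun y hy => ?_
      by_contra hne
      exact hy ⟨Fin.cons t y, subset_tsupport f hne, by simp⟩
    -- The induction hypothesis on slices says that the marginals satisfy the pointwise condition
    -- with s + n in place of s; integrating the first coordinate raises this to s + n + 1.
    have h1 := borell_brascamp_lieb_real (s := s + n) (continuous_integral_finCons hf hfc)
      (continuous_integral_finCons hg hgc) (continuous_integral_finCons hh hhc)
      (hasCompactSupport_integral_finCons hfc) (hasCompactSupport_integral_finCons hgc)
      (hasCompactSupport_integral_finCons hhc) (fun t => integral_nonneg fun y => hf0 _)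
      (fun t => integral_nonneg fun y => hg0 _) (fun t => integral_nonneg fun y => hh0 _)
      hfi hgi hl hk (by positivity) fun t t' ht ht' => by
        refine ih (hsec hf t) (hsec hg t') (hsec hh _) (hsecc hfc t) (hsecc hgc t') (hsecc hhc _)
          (fun y => hf0 _) (fun y => hg0 _) (fun y => hh0 _) ht ht' fun x y hx hy => ?_
        have := hfgh _ _ hx hy
        have e : l • (Fin.cons t x : Fin (n + 1) → ℝ) + k • (Fin.cons t' y : Fin (n + 1) → ℝ) =
            Fin.cons (l * t + k * t') (l • x + k • y) := by
          ext i
          refine Fin.cases ?_ (fun i => ?_) i <;> simp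
        rwa [e] at this
    rw [add_assoc] at h1
    push_cast
    exact h1

/-- The Borell–Brascamp–Lieb inequality on Euclidean space. -/
theorem borell_brascamp_lieb {n : ℕ} {l k s : ℝ} (hl : 0 < l) (hk : 0 < k) (hs : 0 < s)
    {f g h : EuclideanSpace ℝ (Fin n) → ℝ} (hf : Continuous f) (hg : Continuous g)
    (hh : Continuous h) (hfc : HasCompactSupport f) (hgc : HasCompactSupport g)
    (hhc : HasCompactSupport h) (hf0 : ∀ x, 0 ≤ f x) (hg0 : ∀ x, 0 ≤ g x) (hh0 : ∀ x, 0 ≤ h x)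
    (hfi : 0 < ∫ x, f x) (hgi : 0 < ∫ x, g x)
    (hfgh : ∀ x y, 0 < f x → 0 < g y →
      (l * f x ^ (1 / s) + k * g y ^ (1 / s)) ^ s ≤ h (l • x + k • y)) :
    (l * (∫ x, f x) ^ (1 / (s + n)) + k * (∫ x, g x) ^ (1 / (s + n))) ^ (s + n) ≤ ∫ x, h x := by
  have hi : ∀ f : EuclideanSpace ℝ (Fin n) → ℝ, ∫ x, f x = ∫ x, f (WithLp.toLp 2 x) := fun f =>
    ((PiLp.volume_preserving_toLp (Fin n)).integral_comp
      (MeasurableEquiv.toLp 2 (Fin n → ℝ)).measurableEmbedding f).symm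
  have hcont : Continuous (WithLp.toLp 2 : (Fin n → ℝ) → EuclideanSpace ℝ (Fin n)) :=
    PiLp.continuous_toLp 2 _
  have hcs : ∀ {f : EuclideanSpace ℝ (Fin n) → ℝ}, HasCompactSupport f →
      HasCompactSupport fun x : Fin n → ℝ => f (WithLp.toLp 2 x) := fun hf =>
    hf.comp_homeomorph (PiLp.homeomorph 2 (fun _ : Fin n => ℝ)).symm
  rw [hi f] at hfi ⊢
  rw [hi g] at hgi ⊢
  rw [hi h]
  exact borell_brascamp_lieb_pi hl hk hs n (hf.comp hcont) (hg.comp hcont) (hh.comp hcont)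
    (hcs hfc) (hcs hgc) (hcs hhc) (fun x => hf0 _) (fun x => hg0 _) (fun x => hh0 _) hfi hgi
    fun x y hx hy => by simpa using hfgh _ _ hx hy

/-! ### From pointwise inequalities to inequalities of norms -/

/-- A nonnegative function on a bounded open set, continuous up to the boundary, where it
vanishes. -/
structure IsNonnegVanishing {n : ℕ} (Ω : Set (EuclideanSpace ℝ (Fin n)))
    (u : EuclideanSpace ℝ (Fin n) → ℝ) : Prop where
  isOpen : IsOpen Ω
  isBounded : Bornology.IsBounded Ω
  continuousOn : ContinuousOn u (closure Ω)
  boundary : ∀ x ∈ frontier Ω, u x = 0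
  nonneg : ∀ x ∈ closure Ω, 0 ≤ u x

namespace IsNonnegVanishing

variable {n : ℕ} {Ω : Set (EuclideanSpace ℝ (Fin n))} {u : EuclideanSpace ℝ (Fin n) → ℝ}

theorem indicator_nonneg (hu : IsNonnegVanishing Ω u) (x : EuclideanSpace ℝ (Fin n)) :
    0 ≤ Ω.indicator u x :=
  Set.indicator_nonneg (fun y hy => hu.nonneg y (subset_closure hy)) x

theorem continuous_indicator_rpow (hu : IsNonnegVanishing Ω u) {r : ℝ} (hr : 0 < r) :
    Continuous fun x => Ω.indicator u x ^ r :=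
  (continuous_indicator hu.boundary hu.continuousOn).rpow_const fun _ => Or.inr hr.le

theorem hasCompactSupport_indicator_rpow (hu : IsNonnegVanishing Ω u) {r : ℝ} (hr : 0 < r) :
    HasCompactSupport fun x => Ω.indicator u x ^ r := by
  refine HasCompactSupport.intro hu.isBounded.isCompact_closure fun x hx => ?_
  rw [indicator_of_notMem fun h => hx (subset_closure h), Real.zero_rpow hr.ne']

theorem exists_mem_isMax (hu : IsNonnegVanishing Ω u) (hne : Ω.Nonempty) :
    ∃ x ∈ Ω, ∀ y ∈ Ω, u y ≤ u x := by
  obtain ⟨x, hx, hmax⟩ := hu.isBounded.isCompact_closure.exists_isMaxOn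
    (hne.mono subset_closure) hu.continuousOn
  by_cases hxΩ : x ∈ Ω
  · exact ⟨x, hxΩ, fun y hy => hmax (subset_closure hy)⟩
  -- A maximum on the frontier has value 0, so u vanishes on Ω and any point of Ω is a maximum.
  · have hx0 : u x = 0 := hu.boundary x (by rw [hu.isOpen.frontier_eq]; exact ⟨hx, hxΩ⟩)
    obtain ⟨z, hz⟩ := hne
    refine ⟨z, hz, fun y hy => ?_⟩
    have h1 : u y ≤ u x := hmax (subset_closure hy)
    have h2 := hu.nonneg z (subset_closure hz)
    linarith

theorem aestronglyMeasurable (hu : IsNonnegVanishing Ω u) :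
    AEStronglyMeasurable u (volume.restrict Ω) :=
  (hu.continuousOn.mono subset_closure).aestronglyMeasurable hu.isOpen.measurableSet

theorem memLp (hu : IsNonnegVanishing Ω u) (r : ℝ≥0∞) : MemLp u r (volume.restrict Ω) := by
  have : IsFiniteMeasure (volume.restrict Ω) := ⟨by
    rw [Measure.restrict_apply_univ]
    exact hu.isBounded.measure_lt_top⟩
  obtain ⟨C, hC⟩ := hu.isBounded.isCompact_closure.exists_bound_of_continuousOn hu.continuousOn
  refine MemLp.of_bound hu.aestronglyMeasurable C ?_
  filter_upwards [ae_restrict_mem hu.isOpen.measurableSet] with x hx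
  exact hC x (subset_closure hx)

theorem lpNorm_eq (hu : IsNonnegVanishing Ω u) {r : ℝ} (hr : 0 < r) :
    lpNorm u (ENNReal.ofReal r) (volume.restrict Ω) = (∫ x, Ω.indicator u x ^ r) ^ (1 / r) := by
  rw [lpNorm_eq_integral_norm_rpow_toReal (by simpa using hr) ENNReal.ofReal_ne_top
    hu.aestronglyMeasurable, ENNReal.toReal_ofReal hr.le, one_div,
    ← integral_indicator hu.isOpen.measurableSet]
  congr 2
  ext x
  by_cases hx : x ∈ Ω
  · simp [hx, abs_of_nonneg (hu.nonneg x (subset_closure hx))]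
  · simp [hx, Real.zero_rpow hr.ne']

theorem lpNorm_top_le (hu : IsNonnegVanishing Ω u) {C : ℝ} (hC0 : 0 ≤ C)
    (hC : ∀ x ∈ Ω, u x ≤ C) : lpNorm u ∞ (volume.restrict Ω) ≤ C := by
  rw [← toReal_eLpNorm hu.aestronglyMeasurable, eLpNorm_exponent_top]
  refine ENNReal.toReal_le_of_le_ofReal hC0 (eLpNormEssSup_le_of_ae_bound ?_)
  filter_upwards [ae_restrict_mem hu.isOpen.measurableSet] with x hx
  rw [Real.norm_of_nonneg (hu.nonneg x (subset_closure hx))]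
  exact hC x hx

theorem le_lpNorm_top (hu : IsNonnegVanishing Ω u) {x : EuclideanSpace ℝ (Fin n)} (hx : x ∈ Ω) :
    u x ≤ lpNorm u ∞ (volume.restrict Ω) := by
  by_contra! hlt
  have hae := ae_le_lpNorm_exponent_top (hu.memLp ∞)
  rw [ae_restrict_iff' hu.isOpen.measurableSet] at hae
  -- A value above the essential supremum would persist on a nonempty open set, which has positive
  -- measure.
  have hopen : IsOpen (Ω ∩ u ⁻¹' Ioi (lpNorm u ∞ (volume.restrict Ω))) :=
    (hu.continuousOn.mono subset_closure).isOpen_inter_preimage hu.isOpen isOpen_Ioi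
  have hpos := hopen.measure_pos volume ⟨x, hx, hlt⟩
  refine hpos.ne' (measure_mono_null ?_ hae)
  rintro y ⟨hy, hyu⟩ h
  have h1 := h hy
  rw [Real.norm_of_nonneg (hu.nonneg y (subset_closure hy))] at h1
  exact absurd h1 (not_le.2 hyu)

end IsNonnegVanishing

/-- Covers the case in which the other function has zero integral: the change of variables y ↦ c + k
• y supplies the factor k ^ n. -/
theorem integral_rpow_mul_le {n : ℕ} {g h : EuclideanSpace ℝ (Fin n) → ℝ} (hg : Continuous g)
    (hh : Continuous h) (hgc : HasCompactSupport g) (hhc : HasCompactSupport h)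
    {k s : ℝ} (hk : 0 < k) (c : EuclideanSpace ℝ (Fin n))
    (hgh : ∀ y, k ^ s * g y ≤ h (c + k • y)) : k ^ (s + n) * (∫ x, g x) ≤ ∫ x, h x := by
  have h1 : ∫ x, h (c + k • x) = (k ^ n)⁻¹ * ∫ x, h x := by
    have := Measure.integral_comp_smul (volume : Measure (EuclideanSpace ℝ (Fin n)))
      (fun y => h (c + y)) k
    rw [this, integral_add_left_eq_self h c, finrank_euclideanSpace_fin,
      abs_of_pos (by positivity), smul_eq_mul]
  have hcs : HasCompactSupport fun x => h (c + k • x) :=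
    hhc.comp_homeomorph ((Homeomorph.smulOfNeZero k hk.ne').trans (Homeomorph.addLeft c))
  have h2 : ∫ x, k ^ s * g x ≤ ∫ x, h (c + k • x) :=
    integral_mono ((hg.integrable_of_hasCompactSupport hgc).const_mul _)
      ((hh.comp (by fun_prop : Continuous fun x => c + k • x)).integrable_of_hasCompactSupport hcs)
      hgh
  rw [integral_const_mul, h1, inv_mul_eq_div, le_div_iff₀ (by positivity)] at h2
  rw [Real.rpow_add hk, Real.rpow_natCast]
  linarith

/-- The Borell–Brascamp–Lieb inequality for continuous functions with compact support, one of
which may vanish identically. -/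
theorem borell_brascamp_lieb_of_nonneg {n : ℕ} {l k s : ℝ} (hl : 0 < l) (hk : 0 < k) (hs : 0 < s)
    {f g h : EuclideanSpace ℝ (Fin n) → ℝ} (hf : Continuous f) (hg : Continuous g)
    (hh : Continuous h) (hfc : HasCompactSupport f) (hgc : HasCompactSupport g)
    (hhc : HasCompactSupport h) (hf0 : ∀ x, 0 ≤ f x) (hg0 : ∀ x, 0 ≤ g x) (hh0 : ∀ x, 0 ≤ h x)
    {x₀ y₀ : EuclideanSpace ℝ (Fin n)} (hx₀ : ∀ y, k ^ s * g y ≤ h (l • x₀ + k • y))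
    (hy₀ : ∀ x, l ^ s * f x ≤ h (l • x + k • y₀))
    (hfgh : ∀ x y, 0 < f x → 0 < g y →
      (l * f x ^ (1 / s) + k * g y ^ (1 / s)) ^ s ≤ h (l • x + k • y)) :
    (l * (∫ x, f x) ^ (1 / (s + n)) + k * (∫ x, g x) ^ (1 / (s + n))) ^ (s + n) ≤ ∫ x, h x := by
  have hsn : 0 < s + n := by positivity
  have hIf : 0 ≤ ∫ x, f x := integral_nonneg hf0
  have hIg : 0 ≤ ∫ x, g x := integral_nonneg hg0
  have e : ∀ {k I : ℝ}, 0 < k → 0 ≤ I → (k * I ^ (1 / (s + n))) ^ (s + n) = k ^ (s + n) * I :=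
    fun {k I} hk hI => by
      rw [Real.mul_rpow hk.le (by positivity), ← Real.rpow_mul hI, one_div_mul_cancel hsn.ne',
        Real.rpow_one]
  rcases hIf.eq_or_lt with hf1 | hf1
  · rw [← hf1, Real.zero_rpow (by positivity), mul_zero, zero_add, e hk hIg]
    exact integral_rpow_mul_le hg hh hgc hhc hk (l • x₀) hx₀
  rcases hIg.eq_or_lt with hg1 | hg1
  · rw [← hg1, Real.zero_rpow (by positivity), mul_zero, add_zero, e hl hIf]
    exact integral_rpow_mul_le hf hh hfc hhc hl (k • y₀) fun x => by
      rw [add_comm]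
      exact hy₀ x
  exact borell_brascamp_lieb hl hk hs hf hg hh hfc hgc hhc hf0 hg0 hh0 hf1 hg1 hfgh

section Combination

variable {n : ℕ} {Ω₀ Ω₁ U : Set (EuclideanSpace ℝ (Fin n))}
  {u₀ u₁ w : EuclideanSpace ℝ (Fin n) → ℝ} {l k t : ℝ}

/-- A pointwise power mean inequality between functions vanishing on the boundary implies a power
mean inequality between their `L^r` norms. -/
theorem powerMean_lpNorm_le (h₀ : IsNonnegVanishing Ω₀ u₀) (h₁ : IsNonnegVanishing Ω₁ u₁)
    (hw : IsNonnegVanishing U w) (hne₀ : Ω₀.Nonempty) (hne₁ : Ω₁.Nonempty) (hl : 0 < l)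
    (hk : 0 < k) (ht : 0 < t) (hmem : ∀ x₀ ∈ Ω₀, ∀ x₁ ∈ Ω₁, l • x₀ + k • x₁ ∈ U)
    (hle : ∀ x₀ ∈ Ω₀, ∀ x₁ ∈ Ω₁,
      (l * u₀ x₀ ^ (1 / t) + k * u₁ x₁ ^ (1 / t)) ^ t ≤ w (l • x₀ + k • x₁))
    {r : ℝ} (hr : 0 < r) :
    (l * lpNorm u₀ (ENNReal.ofReal r) (volume.restrict Ω₀) ^ (1 / (t + n / r)) +
      k * lpNorm u₁ (ENNReal.ofReal r) (volume.restrict Ω₁) ^ (1 / (t + n / r))) ^ (t + n / r) ≤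
    lpNorm w (ENNReal.ofReal r) (volume.restrict U) := by
  obtain ⟨x₀, hx₀⟩ := hne₀
  obtain ⟨x₁, hx₁⟩ := hne₁
  -- The r-th powers satisfy the pointwise condition with parameter t r. Integration gives t r + n,
  -- and the r-th root turns this into t + n / r.
  have hs : 0 < t * r := by positivity
  have hn0 : ∀ x ∈ Ω₀, 0 ≤ u₀ x := fun x hx => h₀.nonneg x (subset_closure hx)
  have hn1 : ∀ x ∈ Ω₁, 0 ≤ u₁ x := fun x hx => h₁.nonneg x (subset_closure hx)
  have hpw : ∀ {a : ℝ}, 0 ≤ a → (a ^ r) ^ (1 / (t * r)) = a ^ (1 / t) := fun {a} ha => by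
    rw [← Real.rpow_mul ha]
    congr 1
    field_simp
  have hroot : ∀ {a c : ℝ}, 0 ≤ a → 0 ≤ c → (c * a ^ (1 / t)) ^ (t * r) = c ^ (t * r) * a ^ r :=
    fun {a c} ha hc => by
      rw [Real.mul_rpow hc (by positivity), ← Real.rpow_mul ha]
      congr 2
      field_simp
  have hmain : ∀ x ∈ Ω₀, ∀ y ∈ Ω₁, (l * u₀ x ^ (1 / t) + k * u₁ y ^ (1 / t)) ^ (t * r) ≤
      U.indicator w (l • x + k • y) ^ r := fun x hx y hy => by
    have a0 := hn0 x hx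
    have a1 := hn1 y hy
    rw [indicator_of_mem (hmem x hx y hy), Real.rpow_mul (by positivity)]
    exact Real.rpow_le_rpow (by positivity) (hle x hx y hy) hr.le
  have hrhs : ∀ x, 0 ≤ U.indicator w x ^ r := fun x => Real.rpow_nonneg (hw.indicator_nonneg x) _
  have hbbl := borell_brascamp_lieb_of_nonneg hl hk hs (h₀.continuous_indicator_rpow hr)
    (h₁.continuous_indicator_rpow hr) (hw.continuous_indicator_rpow hr)
    (h₀.hasCompactSupport_indicator_rpow hr) (h₁.hasCompactSupport_indicator_rpow hr)
    (hw.hasCompactSupport_indicator_rpow hr)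
    (fun x => Real.rpow_nonneg (h₀.indicator_nonneg x) _)
    (fun x => Real.rpow_nonneg (h₁.indicator_nonneg x) _) hrhs (x₀ := x₀) (y₀ := x₁)
    (fun y => by
      by_cases hy : y ∈ Ω₁
      · refine le_trans ?_ (hmain x₀ hx₀ y hy)
        have a0 := hn0 x₀ hx₀
        have a1 := hn1 y hy
        rw [indicator_of_mem hy, ← hroot a1 hk.le]
        refine Real.rpow_le_rpow (by positivity) ?_ hs.le
        have : 0 ≤ l * u₀ x₀ ^ (1 / t) := by positivity
        linarith
      · rw [indicator_of_notMem hy, Real.zero_rpow hr.ne', mul_zero]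
        exact hrhs _)
    (fun x => by
      by_cases hx : x ∈ Ω₀
      · refine le_trans ?_ (hmain x hx x₁ hx₁)
        have a0 := hn0 x hx
        have a1 := hn1 x₁ hx₁
        rw [indicator_of_mem hx, ← hroot a0 hl.le]
        refine Real.rpow_le_rpow (by positivity) ?_ hs.le
        have : 0 ≤ k * u₁ x₁ ^ (1 / t) := by positivity
        linarith
      · rw [indicator_of_notMem hx, Real.zero_rpow hr.ne', mul_zero]
        exact hrhs _)
    (fun x y hx hy => by
      have hx' : x ∈ Ω₀ := by
        by_contra h
        rw [indicator_of_notMem h, Real.zero_rpow hr.ne'] at hx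
        exact hx.false
      have hy' : y ∈ Ω₁ := by
        by_contra h
        rw [indicator_of_notMem h, Real.zero_rpow hr.ne'] at hy
        exact hy.false
      refine le_trans (le_of_eq ?_) (hmain x hx' y hy')
      rw [indicator_of_mem hx', indicator_of_mem hy', hpw (hn0 x hx'), hpw (hn1 y hy')])
  rw [h₀.lpNorm_eq hr, h₁.lpNorm_eq hr, hw.lpNorm_eq hr]
  have hI₀ : 0 ≤ ∫ x, Ω₀.indicator u₀ x ^ r :=
    integral_nonneg fun x => Real.rpow_nonneg (h₀.indicator_nonneg x) _
  have hI₁ : 0 ≤ ∫ x, Ω₁.indicator u₁ x ^ r :=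
    integral_nonneg fun x => Real.rpow_nonneg (h₁.indicator_nonneg x) _
  have e1 : 1 / r * (1 / (t + n / r)) = 1 / (t * r + n) := by field_simp
  have e2 : t + n / r = (t * r + n) * (1 / r) := by field_simp
  rw [← Real.rpow_mul hI₀, ← Real.rpow_mul hI₁, e1, e2, Real.rpow_mul (by positivity)]
  exact Real.rpow_le_rpow (by positivity) hbbl (by positivity)

/-- The analogue of `powerMean_lpNorm_le` for the supremum norms. -/
theorem powerMean_lpNorm_top_le (h₀ : IsNonnegVanishing Ω₀ u₀) (h₁ : IsNonnegVanishing Ω₁ u₁)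
    (hw : IsNonnegVanishing U w) (hne₀ : Ω₀.Nonempty) (hne₁ : Ω₁.Nonempty) (hl : 0 < l)
    (hk : 0 < k) (ht : 0 < t) (hmem : ∀ x₀ ∈ Ω₀, ∀ x₁ ∈ Ω₁, l • x₀ + k • x₁ ∈ U)
    (hle : ∀ x₀ ∈ Ω₀, ∀ x₁ ∈ Ω₁,
      (l * u₀ x₀ ^ (1 / t) + k * u₁ x₁ ^ (1 / t)) ^ t ≤ w (l • x₀ + k • x₁)) :
    (l * lpNorm u₀ ∞ (volume.restrict Ω₀) ^ (1 / t) +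
      k * lpNorm u₁ ∞ (volume.restrict Ω₁) ^ (1 / t)) ^ t ≤
    lpNorm w ∞ (volume.restrict U) := by
  obtain ⟨x₀, hx₀, hmax₀⟩ := h₀.exists_mem_isMax hne₀
  obtain ⟨x₁, hx₁, hmax₁⟩ := h₁.exists_mem_isMax hne₁
  have hle₀ := h₀.lpNorm_top_le (h₀.nonneg x₀ (subset_closure hx₀)) hmax₀
  have hle₁ := h₁.lpNorm_top_le (h₁.nonneg x₁ (subset_closure hx₁)) hmax₁
  have hp₀ : 0 ≤ lpNorm u₀ ∞ (volume.restrict Ω₀) := lpNorm_nonneg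
  have hp₁ : 0 ≤ lpNorm u₁ ∞ (volume.restrict Ω₁) := lpNorm_nonneg
  -- The pointwise inequality is evaluated at the maximum points of u₀ and u₁, where the values
  -- dominate the supremum norms.
  refine le_trans ?_ ((hle x₀ hx₀ x₁ hx₁).trans (hw.le_lpNorm_top (hmem x₀ hx₀ x₁ hx₁)))
  gcongr

end Combination

/-! ### Limits of power means and the theorem -/

theorem powerMean_one_div {T : ℝ} (hT : 0 < T) (a b μ : ℝ) :
    powerMean (1 / T) a b μ = ((1 - μ) * a ^ (1 / T) + μ * b ^ (1 / T)) ^ T := by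
  have h : 0 < 1 / T := by positivity
  rw [powerMean, if_neg h.ne', if_neg fun hc => (hc.1.trans h).false, one_div_one_div]

theorem continuousAt_powerMean {p a b μ : ℝ} (hp : 0 < p) :
    ContinuousAt (fun p => powerMean p a b μ) p := by
  have h : (fun p => ((1 - μ) * a ^ p + μ * b ^ p) ^ (1 / p)) =ᶠ[𝓝 p]
      fun p => powerMean p a b μ := by
    filter_upwards [lt_mem_nhds hp] with q hq
    rw [powerMean, if_neg hq.ne', if_neg fun hc => (hc.1.trans hq).false]
  refine ContinuousAt.congr ?_ h
  have hc : ∀ a : ℝ, ContinuousAt (fun q : ℝ => a ^ q) p := fun a =>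
    -- Positivity of the exponent gives continuity even at a = 0, which is needed since solutions
    -- and norms may vanish.
    ContinuousAt.rpow continuousAt_const continuousAt_id (Or.inr hp)
  refine ContinuousAt.rpow ?_ (continuousAt_const.div continuousAt_id hp.ne')
    (Or.inr (by positivity))
  exact (continuousAt_const.mul (hc a)).add (continuousAt_const.mul (hc b))

theorem powerMean_le_of_tendsto {p : ℝ → ℝ} {p' a b μ c : ℝ} (hp' : 0 < p')
    (hp : Filter.Tendsto p Filter.atTop (𝓝 p')) (h : ∀ β, 1 ≤ β → powerMean (p β) a b μ ≤ c) :
    powerMean p' a b μ ≤ c := by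
  refine le_of_tendsto ((continuousAt_powerMean hp').tendsto.comp hp) ?_
  filter_upwards [Filter.eventually_ge_atTop 1] with β hβ
  exact h β hβ

theorem tendsto_exponent {d : ℝ} (hd : 0 ≤ d) :
    Filter.Tendsto (fun β : ℝ => 1 / (2 + 1 / β + d)) Filter.atTop (𝓝 (1 / (2 + d))) := by
  have h : Filter.Tendsto (fun β : ℝ => 1 / β) Filter.atTop (𝓝 0) := by
    simpa using tendsto_inv_atTop_zero (𝕜 := ℝ)
  have h2 : Filter.Tendsto (fun β : ℝ => 2 + 1 / β + d) Filter.atTop (𝓝 (2 + d)) := by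
    simpa using (h.const_add 2).add_const d
  exact tendsto_const_nhds.div h2 (by positivity)

theorem proposition7p1 {n : ℕ} (hn : 1 ≤ n) (μ : ℝ) (hμ : μ ∈ Ioo (0 : ℝ) 1)
    (Ω₀ Ω₁ : Set (EuclideanSpace ℝ (Fin n)))
    (hΩ₀ : Ω₀.Nonempty ∧ IsOpen Ω₀ ∧ Bornology.IsBounded Ω₀ ∧ Convex ℝ Ω₀)
    (hΩ₁ : Ω₁.Nonempty ∧ IsOpen Ω₁ ∧ Bornology.IsBounded Ω₁ ∧ Convex ℝ Ω₁)
    (f : EuclideanSpace ℝ (Fin n) → ℝ)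
    (hf_smooth : ContDiffOn ℝ ∞ f (convexHull ℝ (Ω₀ ∪ Ω₁)))
    (hf_nonneg : ∀ x ∈ convexHull ℝ (Ω₀ ∪ Ω₁), 0 ≤ f x)
    (u₀ u₁ uμ : EuclideanSpace ℝ (Fin n) → ℝ)
    (hu₀ : IsClassicalSolution f Ω₀ u₀)
    (hu₁ : IsClassicalSolution f Ω₁ u₁)
    (huμ : IsViscositySolution f (minkowskiCombination μ Ω₀ Ω₁) uμ) :
    -- the `L^r` norms below are finite
    (∀ r : ℝ≥0∞, MemLp u₀ r (volume.restrict Ω₀) ∧ MemLp u₁ r (volume.restrict Ω₁) ∧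
      MemLp uμ r (volume.restrict (minkowskiCombination μ Ω₀ Ω₁))) ∧
    -- the case `f ^ β` concave
    (∀ β : ℝ, 1 ≤ β → ConcaveOn ℝ (convexHull ℝ (Ω₀ ∪ Ω₁)) (fun x => f x ^ β) →
      (∀ x₀ ∈ Ω₀, ∀ x₁ ∈ Ω₁,
        powerMean (β / (1 + 2 * β)) (u₀ x₀) (u₁ x₁) μ ≤ uμ ((1 - μ) • x₀ + μ • x₁)) ∧
      (∀ r : ℝ, 0 < r →
        powerMean (β * r / (n * β + r * (1 + 2 * β)))
          (lpNorm u₀ (ENNReal.ofReal r) (volume.restrict Ω₀))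
          (lpNorm u₁ (ENNReal.ofReal r) (volume.restrict Ω₁)) μ ≤
        lpNorm uμ (ENNReal.ofReal r) (volume.restrict (minkowskiCombination μ Ω₀ Ω₁))) ∧
      powerMean (β / (1 + 2 * β))
          (lpNorm u₀ ∞ (volume.restrict Ω₀)) (lpNorm u₁ ∞ (volume.restrict Ω₁)) μ ≤
        lpNorm uμ ∞ (volume.restrict (minkowskiCombination μ Ω₀ Ω₁))) ∧
    -- the case of a positive constant `f`
    (∀ c : ℝ, 0 < c → (∀ x ∈ convexHull ℝ (Ω₀ ∪ Ω₁), f x = c) →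
      (∀ x₀ ∈ Ω₀, ∀ x₁ ∈ Ω₁,
        powerMean (1 / 2) (u₀ x₀) (u₁ x₁) μ ≤ uμ ((1 - μ) • x₀ + μ • x₁)) ∧
      (∀ r : ℝ, 0 < r →
        powerMean (r / (n + 2 * r))
          (lpNorm u₀ (ENNReal.ofReal r) (volume.restrict Ω₀))
          (lpNorm u₁ (ENNReal.ofReal r) (volume.restrict Ω₁)) μ ≤
        lpNorm uμ (ENNReal.ofReal r) (volume.restrict (minkowskiCombination μ Ω₀ Ω₁))) ∧
      powerMean (1 / 2)
          (lpNorm u₀ ∞ (volume.restrict Ω₀)) (lpNorm u₁ ∞ (volume.restrict Ω₁)) μ ≤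
        lpNorm uμ ∞ (volume.restrict (minkowskiCombination μ Ω₀ Ω₁))) := by
  obtain ⟨hne₀, ho₀, hb₀, hcv₀⟩ := hΩ₀
  obtain ⟨hne₁, ho₁, hb₁, hcv₁⟩ := hΩ₁
  have hk : 0 < μ := hμ.1
  have hl : 0 < 1 - μ := sub_pos.2 hμ.2
  set U := minkowskiCombination μ Ω₀ Ω₁ with hUdef
  set D := convexHull ℝ (Ω₀ ∪ Ω₁) with hD
  have hD₀ : Ω₀ ⊆ D := subset_union_left.trans (subset_convexHull ℝ _)
  have hD₁ : Ω₁ ⊆ D := subset_union_right.trans (subset_convexHull ℝ _)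
  have hDcv : Convex ℝ D := convex_convexHull ℝ _
  have hUo : IsOpen U := (ho₁.smul₀ hk.ne').add_left
  have hUb : Bornology.IsBounded U := (hb₀.smul₀ _).add (hb₁.smul₀ _)
  have hmem : ∀ x₀ ∈ Ω₀, ∀ x₁ ∈ Ω₁, (1 - μ) • x₀ + μ • x₁ ∈ U := fun x₀ h₀ x₁ h₁ =>
    add_mem_add (smul_mem_smul_set h₀) (smul_mem_smul_set h₁)
  have hUD : U ⊆ D := by
    rintro _ ⟨_, ⟨x₀, h₀, rfl⟩, _, ⟨x₁, h₁, rfl⟩, rfl⟩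
    exact hDcv (hD₀ h₀) (hD₁ h₁) hl.le hk.le (by ring)
  have hf₀ : ∀ x ∈ Ω₀, 0 ≤ f x := fun x hx => hf_nonneg x (hD₀ hx)
  have hf₁ : ∀ x ∈ Ω₁, 0 ≤ f x := fun x hx => hf_nonneg x (hD₁ hx)
  have hfU : ∀ x ∈ U, 0 ≤ f x := fun x hx => hf_nonneg x (hUD hx)
  have hv₀ : IsNonnegVanishing Ω₀ u₀ :=
    ⟨ho₀, hb₀, hu₀.continuousOn, hu₀.boundary, fun x hx => hu₀.nonneg hn ho₀ hb₀ hf₀ hx⟩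
  have hv₁ : IsNonnegVanishing Ω₁ u₁ :=
    ⟨ho₁, hb₁, hu₁.continuousOn, hu₁.boundary, fun x hx => hu₁.nonneg hn ho₁ hb₁ hf₁ hx⟩
  have hvμ : IsNonnegVanishing U uμ :=
    ⟨hUo, hUb, huμ.continuousOn, huμ.boundary, fun x hx => huμ.nonneg hn hUo hUb hfU hx⟩
  -- All exponents have the form 1 / (2 + 1/β + d), with d = n / r for finite r and d = 0 otherwise,
  -- so that `tendsto_exponent` covers every limit β → ∞.
  have hA : ∀ β : ℝ, 1 ≤ β → ConcaveOn ℝ D (fun x => f x ^ β) →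
      (∀ x₀ ∈ Ω₀, ∀ x₁ ∈ Ω₁, powerMean (1 / (2 + 1 / β + 0)) (u₀ x₀) (u₁ x₁) μ ≤
        uμ ((1 - μ) • x₀ + μ • x₁)) ∧
      (∀ r : ℝ, 0 < r → powerMean (1 / (2 + 1 / β + n / r))
          (lpNorm u₀ (ENNReal.ofReal r) (volume.restrict Ω₀))
          (lpNorm u₁ (ENNReal.ofReal r) (volume.restrict Ω₁)) μ ≤
        lpNorm uμ (ENNReal.ofReal r) (volume.restrict U)) ∧
      powerMean (1 / (2 + 1 / β + 0))
          (lpNorm u₀ ∞ (volume.restrict Ω₀)) (lpNorm u₁ ∞ (volume.restrict Ω₁)) μ ≤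
        lpNorm uμ ∞ (volume.restrict U) := by
    intro β hβ hconc
    have hβ0 : 0 < β := by linarith
    have ht : 0 < 2 + 1 / β := by positivity
    have hle : ∀ x₀ ∈ Ω₀, ∀ x₁ ∈ Ω₁,
        ((1 - μ) * u₀ x₀ ^ (1 / (2 + 1 / β)) + μ * u₁ x₁ ^ (1 / (2 + 1 / β))) ^ (2 + 1 / β) ≤
          uμ ((1 - μ) • x₀ + μ • x₁) := fun x₀ h₀ x₁ h₁ =>
      huμ.powerMean_le hn hu₀ hu₁ ho₀ hb₀ ho₁ hb₁ hUo hUb hl hk hβ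
        (one_div_mul_cancel ht.ne') hmem
        (fun y₀ hy₀ y₁ hy₁ => hconc.2 (hD₀ hy₀) (hD₁ hy₁) hl.le hk.le (by ring))
        hf₀ hf₁ hfU (subset_closure h₀) (subset_closure h₁)
    refine ⟨fun x₀ h₀ x₁ h₁ => ?_, fun r hr => ?_, ?_⟩
    · rw [add_zero, powerMean_one_div ht]
      exact hle x₀ h₀ x₁ h₁
    · rw [powerMean_one_div (by positivity)]
      exact powerMean_lpNorm_le hv₀ hv₁ hvμ hne₀ hne₁ hl hk ht hmem hle hr
    · rw [add_zero, powerMean_one_div ht]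
      exact powerMean_lpNorm_top_le hv₀ hv₁ hvμ hne₀ hne₁ hl hk ht hmem hle
  refine ⟨fun r => ⟨hv₀.memLp r, hv₁.memLp r, hvμ.memLp r⟩, fun β hβ hconc => ?_,
    fun c hc hfc => ?_⟩
  · have hβ0 : 0 < β := by linarith
    have e1 : β / (1 + 2 * β) = 1 / (2 + 1 / β + 0) := by
      field_simp
      ring
    obtain ⟨h1, h2, h3⟩ := hA β hβ hconc
    rw [e1]
    refine ⟨h1, fun r hr => ?_, h3⟩
    have e2 : β * r / (n * β + r * (1 + 2 * β)) = 1 / (2 + 1 / β + n / r) := by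
      field_simp
      ring
    rw [e2]
    exact h2 r hr
  -- A constant f has every power concave, so the first case holds for all β ≥ 1 against a
  -- right-hand side independent of β.
  · have hconc : ∀ β : ℝ, ConcaveOn ℝ D (fun x => f x ^ β) := fun β =>
      (concaveOn_const (c ^ β) hDcv).congr fun x hx => by simp only [hfc x hx]
    have e1 : (1 / 2 : ℝ) = 1 / (2 + 0) := by norm_num
    rw [e1]
    refine ⟨fun x₀ h₀ x₁ h₁ => ?_, fun r hr => ?_, ?_⟩
    · exact powerMean_le_of_tendsto (by norm_num) (tendsto_exponent le_rfl)
        fun β hβ => (hA β hβ (hconc β)).1 x₀ h₀ x₁ h₁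
    · have e2 : r / (n + 2 * r) = 1 / (2 + n / r) := by
        field_simp
        ring
      rw [e2]
      exact powerMean_le_of_tendsto (by positivity) (tendsto_exponent (by positivity))
        fun β hβ => (hA β hβ (hconc β)).2.1 r hr
    · exact powerMean_le_of_tendsto (by norm_num) (tendsto_exponent le_rfl)
        fun β hβ => (hA β hβ (hconc β)).2.2
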